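/- A planar triangulation is a finite simple graph $G$ drawn in the plane without crossings such that every face (including the unbounded one) is bounded by a triangle of $G$; it is Eulerian if every vertex has even degree. A permeating subtree of $G$ is an induced subgraph $T$ of $G$ that is a tree and hits every face, that is, each face of $G$ is incident to some vertex of $T$. Theorem. For every integer $k$ there is a properly $3$-coloured Eulerian planar triangulation $G$ such that every permeating subtree of $G$ contains at least $k$ vertices from each colour class, and excludes at least $k$ vertices from each colour class. -/

import Mathlib

/-- `A` is a simple arc in the plane with end points `x` and `y`: the image of an injective
continuous path from `x` to `y`. -/
def IsSimpleArc (x y : ℝ × ℝ) (A : Set (ℝ × ℝ)) : Prop :=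
  ∃ γ : Path x y, Function.Injective γ ∧ Set.range γ = A

/-- A crossing-free drawing of the simple graph `G` in the plane: vertices are distinct points,
each edge is a simple arc joining its two ends, the only vertices on an arc are the ends of the
edge, and two distinct arcs meet only in common ends of the two edges. -/
structure PlaneDrawing {V : Type*} (G : SimpleGraph V) where
  point : V → ℝ × ℝ
  point_injective : Function.Injective point
  arc : G.edgeSet → Set (ℝ × ℝ)
  isSimpleArc_arc : ∀ (e : G.edgeSet) (u v : V), (e : Sym2 V) = s(u, v) →
    IsSimpleArc (point u) (point v) (arc e)
  mem_of_point_mem_arc : ∀ (e : G.edgeSet) (v : V), point v ∈ arc e → v ∈ (e : Sym2 V)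
  arc_inter : ∀ (e f : G.edgeSet), e ≠ f → ∀ x ∈ arc e ∩ arc f,
    ∃ v : V, v ∈ (e : Sym2 V) ∧ v ∈ (f : Sym2 V) ∧ point v = x

namespace PlaneDrawing

variable {V : Type*} {G : SimpleGraph V}

/-- The set of points of the plane covered by the drawing. -/
def support (D : PlaneDrawing G) : Set (ℝ × ℝ) :=
  Set.range D.point ∪ ⋃ e : G.edgeSet, D.arc e

/-- The faces of the drawing (the unbounded one included) are the connected components of the
complement of the drawing. -/
def IsFace (D : PlaneDrawing G) (F : Set (ℝ × ℝ)) : Prop :=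
  ∃ x ∈ D.supportᶜ, F = connectedComponentIn D.supportᶜ x

/-- A vertex is incident to a face if it lies on the boundary of the face. -/
def Incident (D : PlaneDrawing G) (v : V) (F : Set (ℝ × ℝ)) : Prop :=
  D.point v ∈ frontier F

/-- The drawing is a triangulation if every face (the unbounded one included) is bounded by a
triangle of the graph. -/
def IsTriangulation (D : PlaneDrawing G) : Prop :=
  ∀ F : Set (ℝ × ℝ), D.IsFace F →
    ∃ (a b c : V) (hab : G.Adj a b) (hbc : G.Adj b c) (hca : G.Adj c a),
      frontier F = D.arc ⟨s(a, b), hab⟩ ∪ D.arc ⟨s(b, c), hbc⟩ ∪ D.arc ⟨s(c, a), hca⟩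

/-- A subgraph permeates the plane graph if it is induced and hits every face, that is, every
face is incident to some vertex of the subgraph. -/
def Permeates (D : PlaneDrawing G) (H : G.Subgraph) : Prop :=
  H.IsInduced ∧ ∀ F : Set (ℝ × ℝ), D.IsFace F → ∃ v ∈ H.verts, D.Incident v F

/-- A permeating subtree is a permeating subgraph that is a tree. -/
def IsPermeatingSubtree (D : PlaneDrawing G) (H : G.Subgraph) : Prop :=
  D.Permeates H ∧ H.coe.IsTree

end PlaneDrawing

/-- A (finite) graph is Eulerian if every vertex has even degree. -/
def IsEulerianGraph {V : Type*} [Finite V] (G : SimpleGraph V) : Prop :=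
  ∀ v : V, Even (G.neighborSet v).ncard

/-! The engine is the tetrakis hexahedron: a cube with an apex over each of its six faces, the
apices coloured 0 and the eight cube vertices coloured 1 and 2. An induced tree hitting all its
facets, except perhaps an outer and an inner one, contains an apex and omits an apex. If it had
none, its s vertices would cover all edges of the 3-regular cube, and counting degrees gives 4s =
22. If it had all six, the other j tree vertices would be pairwise nonadjacent (two adjacent ones
close a triangle with an apex) and each would see three apices, so 3j = 6 + j - 1. Both are
impossible: `Gadget.exists_mem_color_zero`, `Gadget.exists_notMem_color_zero`.

Now place a triangulation inside the inner facet. The separating triangle is a clique, so an induced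
tree of the whole that meets a side restricts to an induced tree of that side
(`SimpleGraph.IsTree.induce_preimage`). Hence old lower bounds persist, and two nested gadgets add
one vertex of colour 0 inside the tree and one outside (`IsRich.glue_glue`). Shifting the colours
and repeating three times raises every bound by one, and induction finishes (`exists_isRich`).

The topology is handled by straight-line drawings in barycentric coordinates. That the facet cones
tile the nonnegative orthant yields a crossing-free drawing with the expected faces
(`isFace_cases`), and this property passes through nesting. For the gadget itself it is certified by
an integral convex lifting (`Gadget.unique`, `Gadget.cover`). -/

/-! ### Triangulations in barycentric coordinates and their straight-line drawings -/

/-- The graph whose edges are the pairs of distinct vertices lying in a common facet. -/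
def facetGraph {V : Type*} (tri : Set (Finset V)) : SimpleGraph V where
  Adj u v := u ≠ v ∧ ∃ t ∈ tri, u ∈ t ∧ v ∈ t
  symm := ⟨fun _ _ h => ⟨h.1.symm, h.2.imp fun _ ht => ⟨ht.1, ht.2.2, ht.2.1⟩⟩⟩
  loopless := ⟨fun _ h => h.1 rfl⟩

/-- A properly `3`-coloured Eulerian triangulation of a triangle with corners `out i`. The vertex
`v` is drawn at the point with barycentric coordinates `pos v`. Every point of the nonnegative
orthant is a nonnegative combination of the vertices of some facet, in a unique way. -/
structure Triangulation (V : Type) [Fintype V] where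
  tri : Set (Finset V)
  pos : V → Fin 3 → ℝ
  out : Fin 3 → V
  color : V → Fin 3
  card_tri : ∀ t ∈ tri, t.card = 3
  exists_mem_tri : ∀ v, ∃ t ∈ tri, v ∈ t
  pos_nonneg : ∀ v i, 0 ≤ pos v i
  sum_pos : ∀ v, ∑ i, pos v i = 1
  pos_out : ∀ i, pos (out i) = Pi.single i 1
  out_edge : ∀ i j, ∃ t ∈ tri, out i ∈ t ∧ out j ∈ t
  color_out : ∀ i, color (out i) = i
  color_inj : ∀ t ∈ tri, Set.InjOn color t
  even_degree : ∀ v, Even ((facetGraph tri).neighborSet v).ncard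
  unique : ∀ t ∈ tri, ∀ t' ∈ tri, ∀ w w' : V → ℝ, 0 ≤ w → 0 ≤ w' → (∀ v, v ∉ t → w v = 0) →
    (∀ v, v ∉ t' → w' v = 0) → ∑ v, w v • pos v = ∑ v, w' v • pos v → w = w'
  cover : ∀ x : Fin 3 → ℝ, 0 ≤ x → ∃ t ∈ tri, ∃ w : V → ℝ, 0 ≤ w ∧ (∀ v, v ∉ t → w v = 0) ∧
    ∑ v, w v • pos v = x

theorem Sym2.setOf_mem_mk {α : Type*} (u v : α) : {x | x ∈ s(u, v)} = ({u, v} : Set α) := by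
  ext x
  simp

theorem isSimpleArc_segment {x y : ℝ × ℝ} (h : x ≠ y) : IsSimpleArc x y (segment ℝ x y) := by
  refine ⟨⟨⟨fun t => AffineMap.lineMap x y (t : ℝ), by
    exact AffineMap.lineMap_continuous.comp continuous_subtype_val⟩, by simp, by simp⟩, ?_, ?_⟩
  · intro s t hst
    exact Subtype.ext (AffineMap.lineMap_injective ℝ h hst)
  · rw [segment_eq_image_lineMap]
    ext z
    simp [unitInterval]

namespace Triangulation

variable {V : Type} [Fintype V] (W : Triangulation V)

theorem out_injective : Function.Injective W.out := fun i j h => by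
  rw [← W.color_out i, h, W.color_out]

/-- The position of a vertex in the plane. -/
def point (v : V) : ℝ × ℝ := (W.pos v 0, W.pos v 1)

theorem pos_two (v : V) : W.pos v 2 = 1 - W.pos v 0 - W.pos v 1 := by
  have := W.sum_pos v
  rw [Fin.sum_univ_three] at this
  linarith

/-- Barycentric coordinates sum to 1, so the dropped third coordinate is recovered from the total
weight. -/
theorem sum_smul_pos_of_sum_smul_point {w w' : V → ℝ} (h1 : ∑ v, w v = ∑ v, w' v)
    (h : ∑ v, w v • W.point v = ∑ v, w' v • W.point v) :
    ∑ v, w v • W.pos v = ∑ v, w' v • W.pos v := by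
  have h0 := congrArg Prod.fst h
  have h2 := congrArg Prod.snd h
  simp only [Prod.fst_sum, Prod.snd_sum, point, Prod.smul_mk, smul_eq_mul] at h0 h2
  funext i
  simp only [Finset.sum_apply, Pi.smul_apply, smul_eq_mul]
  fin_cases i
  · exact h0
  · exact h2
  · simp only [Fin.reduceFinMk, pos_two, mul_sub, mul_one, Finset.sum_sub_distrib]
    rw [h0, h1, h2]

theorem unique_point {t t' : Finset V} (ht : t ∈ W.tri) (ht' : t' ∈ W.tri) {w w' : V → ℝ}
    (hw : 0 ≤ w) (hw' : 0 ≤ w') (hs : ∀ v, v ∉ t → w v = 0) (hs' : ∀ v, v ∉ t' → w' v = 0)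
    (h1 : ∑ v, w v = ∑ v, w' v) (h : ∑ v, w v • W.point v = ∑ v, w' v • W.point v) : w = w' :=
  W.unique t ht t' ht' w w' hw hw' hs hs' (W.sum_smul_pos_of_sum_smul_point h1 h)

/-- The closed simplex spanned by a set of vertices. -/
def hull (s : Set V) : Set (ℝ × ℝ) :=
  {x | ∃ w : V → ℝ, 0 ≤ w ∧ (∀ v, v ∉ s → w v = 0) ∧ ∑ v, w v = 1 ∧ ∑ v, w v • W.point v = x}

theorem hull_mono {s s' : Set V} (h : s ⊆ s') : W.hull s ⊆ W.hull s' := fun _ ⟨w, h0, h1, h2⟩ =>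
  ⟨w, h0, fun v hv => h1 v fun hv' => hv (h hv'), h2⟩

theorem point_mem_hull {s : Set V} {v : V} (h : v ∈ s) : W.point v ∈ W.hull s := by
  classical
  refine ⟨Pi.single v 1, ?_, ?_, by simp, ?_⟩
  · exact Pi.single_nonneg.2 zero_le_one
  · intro u hu
    exact Pi.single_eq_of_ne (by rintro rfl; exact hu h) _
  · rw [Finset.sum_eq_single v] <;> simp +contextual [Pi.single_eq_of_ne]

/-- A common point has only one weight function, which must then vanish off both sets. This is what
makes the drawing crossing-free. -/
theorem hull_inter {t t' : Finset V} (ht : t ∈ W.tri) (ht' : t' ∈ W.tri) {s s' : Set V}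
    (hs : s ⊆ t) (hs' : s' ⊆ t') : W.hull s ∩ W.hull s' ⊆ W.hull (s ∩ s') := by
  rintro x ⟨⟨w, h0, h1, h2, h3⟩, w', h0', h1', h2', h3'⟩
  obtain rfl := W.unique_point ht ht' h0 h0' (fun v hv => h1 v fun h => hv (hs h))
    (fun v hv => h1' v fun h => hv (hs' h)) (h2.trans h2'.symm) (h3.trans h3'.symm)
  refine ⟨w, h0, fun v hv => ?_, h2, h3⟩
  by_contra hne
  exact hv ⟨by_contra fun h => hne (h1 v h), by_contra fun h => hne (h1' v h)⟩

theorem hull_singleton (v : V) : W.hull {v} = {W.point v} := by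
  refine Set.Subset.antisymm ?_ (by simpa using W.point_mem_hull (Set.mem_singleton v))
  rintro x ⟨w, h0, h1, h2, rfl⟩
  rw [Finset.sum_eq_single v (fun u _ hu => h1 u hu) (by simp)] at h2
  rw [Finset.sum_eq_single v (fun u _ hu => by rw [h1 u hu, zero_smul]) (by simp), h2, one_smul]
  rfl

theorem hull_empty : W.hull ∅ = ∅ := by
  refine Set.eq_empty_of_forall_notMem ?_
  rintro x ⟨w, -, h1, h2, -⟩
  simp [h1] at h2

theorem point_injective : Function.Injective W.point := by
  intro u v h
  obtain ⟨t, ht, hu⟩ := W.exists_mem_tri u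
  obtain ⟨t', ht', hv⟩ := W.exists_mem_tri v
  have := W.hull_inter ht ht' (s := {u}) (s' := {v}) (by simpa using hu) (by simpa using hv)
    ⟨W.point_mem_hull rfl, h ▸ W.point_mem_hull rfl⟩
  by_contra hne
  rw [Set.singleton_inter_eq_empty.2 (Set.mem_singleton_iff.not.2 hne), hull_empty] at this
  exact this

theorem mem_of_point_mem_hull {t : Finset V} (ht : t ∈ W.tri) {s : Set V} (hs : s ⊆ t) {v : V}
    (h : W.point v ∈ W.hull s) : v ∈ s := by
  obtain ⟨t', ht', hv⟩ := W.exists_mem_tri v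
  have := W.hull_inter ht' ht (s := {v}) (by simpa using hv) hs ⟨W.point_mem_hull rfl, h⟩
  by_contra hne
  rw [Set.singleton_inter_eq_empty.2 hne, hull_empty] at this
  exact this

theorem hull_pair {u v : V} (huv : u ≠ v) : W.hull {u, v} = segment ℝ (W.point u) (W.point v) := by
  classical
  have key (w : V → ℝ) (h : ∀ x, x ∉ ({u, v} : Set V) → w x = 0) {M : Type} [AddCommMonoid M]
      [Module ℝ M] (f : V → M) : ∑ x, w x • f x = w u • f u + w v • f v := by
    rw [← Finset.sum_pair (f := fun x => w x • f x) huv]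
    refine (Finset.sum_subset (Finset.subset_univ _) fun x _ hx => ?_).symm
    rw [h x (by simpa using hx), zero_smul]
  ext x
  constructor
  · rintro ⟨w, h0, h1, h2, rfl⟩
    refine ⟨w u, w v, h0 u, h0 v, ?_, (key w h1 _).symm⟩
    simpa using (key w h1 (fun _ => (1 : ℝ))).symm.trans (by simpa using h2)
  · rintro ⟨a, b, ha, hb, hab, rfl⟩
    let w : V → ℝ := fun x => if x = u then a else if x = v then b else 0
    have hw : ∀ x, x ∉ ({u, v} : Set V) → w x = 0 := fun x hx => by
      simp only [Set.mem_insert_iff, Set.mem_singleton_iff, not_or] at hx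
      simp [w, hx.1, hx.2]
    have hu : w u = a := by simp [w]
    have hv : w v = b := by simp [w, huv.symm]
    refine ⟨w, fun x => ?_, hw, ?_, ?_⟩
    · simp only [w, Pi.zero_apply]
      split_ifs <;> first | assumption | exact le_rfl
    · simpa [hu, hv, hab] using key w hw (fun _ => (1 : ℝ))
    · rw [key w hw, hu, hv]

/-- The graph of the triangulation. -/
abbrev graph : SimpleGraph V := facetGraph W.tri

theorem exists_subset_tri (e : W.graph.edgeSet) :
    ∃ t ∈ W.tri, {x | x ∈ (e : Sym2 V)} ⊆ (t : Set V) := by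
  obtain ⟨e, he⟩ := e
  induction e using Sym2.ind with
  | _ u v =>
    obtain ⟨-, t, ht, hu, hv⟩ := he
    refine ⟨t, ht, fun x hx => ?_⟩
    rcases Sym2.mem_iff.1 hx with rfl | rfl
    exacts [hu, hv]

/-- The straight-line drawing of the triangulation. -/
def drawing : PlaneDrawing W.graph where
  point := W.point
  point_injective := W.point_injective
  arc e := W.hull {x | x ∈ (e : Sym2 V)}
  isSimpleArc_arc e u v h := by
    have huv : u ≠ v := by
      have := e.2
      rw [h] at this
      exact this.1
    rw [h, Sym2.setOf_mem_mk, W.hull_pair huv]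
    exact isSimpleArc_segment (W.point_injective.ne huv)
  mem_of_point_mem_arc e v h := by
    obtain ⟨t, ht, hs⟩ := W.exists_subset_tri e
    exact W.mem_of_point_mem_hull ht hs h
  arc_inter e f hef x hx := by
    obtain ⟨t, ht, hs⟩ := W.exists_subset_tri e
    obtain ⟨t', ht', hs'⟩ := W.exists_subset_tri f
    have hx' := W.hull_inter ht ht' hs hs' hx
    obtain h | ⟨v, hv⟩ := ({x | x ∈ (e : Sym2 V)} ∩ {x | x ∈ (f : Sym2 V)}).eq_empty_or_nonempty
    · rw [h, hull_empty] at hx'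
      exact hx'.elim
    · refine ⟨v, hv.1, hv.2, ?_⟩
      have : {x | x ∈ (e : Sym2 V)} ∩ {x | x ∈ (f : Sym2 V)} ⊆ {v} := by
        intro u hu
        by_contra hne
        have h1 := (Sym2.mem_and_mem_iff hne).1 ⟨hu.1, hv.1⟩
        have h2 := (Sym2.mem_and_mem_iff hne).1 ⟨hu.2, hv.2⟩
        exact hef (Subtype.ext (h1.trans h2.symm))
      have := W.hull_mono this hx'
      rw [hull_singleton] at this
      exact this.symm

theorem drawing_arc {u v : V} (h : W.graph.Adj u v) :
    W.drawing.arc ⟨s(u, v), h⟩ = W.hull {u, v} := by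
  simp only [drawing, Sym2.setOf_mem_mk]

end Triangulation

/-! ### Faces of the drawing -/

/-- A connected set avoiding `S`, hence avoiding the frontier of `O`, lies in the union of the open
sets `O` and the exterior of `O`; if it meets `O` it stays there. -/
theorem connectedComponentIn_compl_eq {X : Type*} [TopologicalSpace X] {S O : Set X} {x : X}
    (hO : IsOpen O) (hc : IsPreconnected O) (hd : Disjoint O S) (hf : frontier O ⊆ S) (hx : x ∈ O) :
    connectedComponentIn Sᶜ x = O := by
  have hOS : O ⊆ Sᶜ := hd.subset_compl_right
  refine Set.Subset.antisymm ?_ (hc.subset_connectedComponentIn hx hOS)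
  refine isPreconnected_connectedComponentIn.subset_left_of_subset_union hO
    (isClosed_closure (s := O)).isOpen_compl ?_ ?_ ⟨x, mem_connectedComponentIn (hOS hx), hx⟩
  · exact (Set.disjoint_left.2 fun y hy hy' => hy' (subset_closure hy))
  · intro y hy
    by_contra hn
    simp only [Set.mem_union, Set.mem_compl_iff, not_or, not_not] at hn
    have : y ∈ frontier O := by rw [hO.frontier_eq]; exact ⟨hn.2, hn.1⟩
    exact connectedComponentIn_subset _ _ hy (hf this)

namespace Triangulation

variable {V : Type} [Fintype V] (W : Triangulation V)

theorem sum_extend {ι : Type*} [Fintype ι] {g : ι → V} (hg : Function.Injective g) (w : ι → ℝ)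
    {M : Type*} [AddCommMonoid M] [Module ℝ M] (f : V → M) :
    ∑ v, Function.extend g w 0 v • f v = ∑ i, w i • f (g i) := by
  refine (Fintype.sum_of_injective g hg _ _ (fun v hv => ?_) fun i => ?_).symm
  · rw [Function.extend_apply' _ _ _ (by simpa using hv)]
    simp
  · rw [hg.extend_apply]

/-- The vertices in `t` are affinely independent, expressed through nonnegative weights. -/
def Indep (t : Finset V) : Prop :=
  ∀ w w' : V → ℝ, 0 ≤ w → 0 ≤ w' → (∀ v, v ∉ t → w v = 0) →
    (∀ v, v ∉ t → w' v = 0) → ∑ v, w v • W.pos v = ∑ v, w' v • W.pos v → w = w'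

theorem indep_of_mem {t : Finset V} (ht : t ∈ W.tri) : W.Indep t := W.unique t ht t ht

/-- The positive and negative parts of an affine dependency are two nonnegative weights with the
same image, so they coincide and the dependency is zero. -/
theorem affineIndependent {t : Finset V} (ht : W.Indep t) :
    AffineIndependent ℝ (fun v : t => W.point v) := by
  rw [affineIndependent_iff_of_fintype]
  intro w hw h i
  rw [Finset.weightedVSub_eq_linear_combination (hw := hw)] at h
  set z : V → ℝ := Function.extend Subtype.val w 0 with hz
  have hz0 : ∀ v, v ∉ t → z v = 0 := fun v hv => by
    rw [hz, Function.extend_apply' _ _ _ (by simpa using hv)]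
    rfl
  have h1 : ∑ v, z v = 0 := by
    rw [← hw]
    simpa only [smul_eq_mul, mul_one] using
      sum_extend Subtype.val_injective w (fun _ => (1 : ℝ))
  have h2 : ∑ v, z v • W.point v = 0 := (sum_extend Subtype.val_injective w W.point).trans h
  have hp : z⁺ = z⁻ := by
    refine ht _ _ (posPart_nonneg z) (negPart_nonneg z) (fun v hv => ?_) (fun v hv => ?_)
      (W.sum_smul_pos_of_sum_smul_point ?_ ?_)
    · simp [hz0 v hv]
    · simp [hz0 v hv]
    · rw [← sub_eq_zero, ← Finset.sum_sub_distrib, ← h1]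
      exact Finset.sum_congr rfl fun v _ => congrFun (posPart_sub_negPart z) v
    · rw [← sub_eq_zero, ← Finset.sum_sub_distrib, ← h2]
      refine Finset.sum_congr rfl fun v _ => ?_
      rw [← sub_smul]
      exact congrArg (· • W.point v) (congrFun (posPart_sub_negPart z) v)
  have := congrFun (posPart_sub_negPart z) i
  rw [hp, sub_self, hz, Subtype.val_injective.extend_apply] at this
  exact this.symm

/-- The affine basis of the plane formed by the vertices in `t`. -/
noncomputable def basis {t : Finset V} (hc : t.card = 3) (ht : W.Indep t) :
    AffineBasis t ℝ (ℝ × ℝ) where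
  toFun v := W.point v
  ind' := W.affineIndependent ht
  tot' := by
    rw [(W.affineIndependent ht).affineSpan_eq_top_iff_card_eq_finrank_add_one]
    simp [hc]

section

variable {t : Finset V} (hc : t.card = 3) (ht : W.Indep t)

theorem sum_subtype_of_support {w : V → ℝ} (hw : ∀ v, v ∉ t → w v = 0) {M : Type*}
    [AddCommMonoid M] [Module ℝ M] (f : V → M) : ∑ v, w v • f v = ∑ v : t, w v • f v := by
  rw [Finset.sum_coe_sort t (fun v => w v • f v)]
  exact (Finset.sum_subset (Finset.subset_univ t) fun v _ hv => by rw [hw v hv, zero_smul]).symm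

theorem coord_sum {w : V → ℝ} (hw : ∀ v, v ∉ t → w v = 0) (h1 : ∑ v, w v = 1) (i : t) :
    (W.basis hc ht).coord i (∑ v, w v • W.point v) = w i := by
  have h2 : ∑ v : t, w v = 1 := by
    rw [← h1]
    simpa using (sum_subtype_of_support hw (fun _ => (1 : ℝ))).symm
  rw [sum_subtype_of_support hw]
  have := (W.basis hc ht).coord_apply_combination_of_mem (Finset.mem_univ i) h2
  rwa [Finset.affineCombination_eq_linear_combination _ _ _ h2] at this

theorem exists_weight (x : ℝ × ℝ) : ∃ w : V → ℝ, (∀ v, v ∉ t → w v = 0) ∧ ∑ v, w v = 1 ∧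
    ∑ v, w v • W.point v = x ∧ ∀ i : t, w i = (W.basis hc ht).coord i x := by
  refine ⟨Function.extend Subtype.val (fun i => (W.basis hc ht).coord i x) 0, fun v hv => ?_, ?_,
    ?_, fun i => Subtype.val_injective.extend_apply _ _ i⟩
  · rw [Function.extend_apply' _ _ _ (by simpa using hv)]
    rfl
  · rw [← (W.basis hc ht).sum_coord_apply_eq_one x]
    simpa only [smul_eq_mul, mul_one] using
      sum_extend Subtype.val_injective (fun i => (W.basis hc ht).coord i x) (fun _ => (1 : ℝ))
  · exact (sum_extend Subtype.val_injective _ W.point).trans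
      ((W.basis hc ht).linear_combination_coord_eq_self x)

theorem hull_eq_coord_nonneg : W.hull t = {x | ∀ i, 0 ≤ (W.basis hc ht).coord i x} := by
  ext x
  constructor
  · rintro ⟨w, h0, h1, h2, rfl⟩ i
    rw [W.coord_sum hc ht h1 h2]
    exact h0 i
  · intro h
    obtain ⟨w, h1, h2, h3, h4⟩ := W.exists_weight hc ht x
    refine ⟨w, fun v => ?_, h1, h2, h3⟩
    by_cases hv : v ∈ t
    · exact (h ⟨v, hv⟩).trans_eq (h4 ⟨v, hv⟩).symm
    · exact (h1 v hv).ge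

theorem hull_erase_eq [DecidableEq V] (i : t) : W.hull (t.erase i) =
    {x | (∀ j, 0 ≤ (W.basis hc ht).coord j x) ∧ (W.basis hc ht).coord i x = 0} := by
  ext x
  constructor
  · rintro ⟨w, h0, h1, h2, rfl⟩
    have h1' : ∀ v, v ∉ t → w v = 0 := fun v hv => h1 v (by simp [hv])
    refine ⟨fun j => ?_, ?_⟩
    · rw [W.coord_sum hc ht h1' h2]
      exact h0 j
    · rw [W.coord_sum hc ht h1' h2]
      exact h1 i (by simp)
  · rintro ⟨h, hi⟩
    obtain ⟨w, h1, h2, h3, h4⟩ := W.exists_weight hc ht x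
    refine ⟨w, fun v => ?_, fun v hv => ?_, h2, h3⟩
    · by_cases hv : v ∈ t
      · exact (h ⟨v, hv⟩).trans_eq (h4 ⟨v, hv⟩).symm
      · exact (h1 v hv).ge
    · by_cases hvt : v ∈ t
      · have : v = i := by simpa [hvt] using hv
        rw [this, h4, hi]
      · exact h1 v hvt

theorem hull_eq_convexHull : W.hull t = convexHull ℝ (Set.range (W.basis hc ht)) := by
  rw [(W.basis hc ht).convexHull_eq_nonneg_coord, hull_eq_coord_nonneg]

theorem interior_hull : interior (W.hull t) = {x | ∀ i, 0 < (W.basis hc ht).coord i x} := by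
  rw [W.hull_eq_convexHull hc ht, (W.basis hc ht).interior_convexHull]

theorem isClosed_hull (hc : t.card = 3) (ht : W.Indep t) : IsClosed (W.hull t) := by
  rw [W.hull_eq_convexHull hc ht]
  exact (Set.finite_range _).isClosed_convexHull ℝ

theorem convex_hull (hc : t.card = 3) (ht : W.Indep t) : Convex ℝ (W.hull t) := by
  rw [W.hull_eq_convexHull hc ht]
  exact convex_convexHull _ _

theorem interior_hull_nonempty (hc : t.card = 3) (ht : W.Indep t) :
    (interior (W.hull t)).Nonempty := by
  rw [W.hull_eq_convexHull hc ht]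
  have : Nonempty t := by
    rw [← Fintype.card_pos_iff]
    simp [hc]
  exact ⟨_, (W.basis hc ht).centroid_mem_interior_convexHull⟩

theorem frontier_hull [DecidableEq V] (hc : t.card = 3) (ht : W.Indep t) :
    frontier (W.hull t) = ⋃ v ∈ t, W.hull (t.erase v) := by
  ext x
  rw [(W.isClosed_hull hc ht).frontier_eq, W.interior_hull hc ht, W.hull_eq_coord_nonneg hc ht]
  simp only [Set.mem_sdiff, Set.mem_ofPred_eq, not_forall, not_lt, Set.mem_iUnion]
  constructor
  · rintro ⟨h, i, hi⟩
    refine ⟨i, i.2, ?_⟩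
    rw [W.hull_erase_eq hc ht i]
    exact ⟨h, le_antisymm hi (h i)⟩
  · rintro ⟨i, hi, h⟩
    rw [W.hull_erase_eq hc ht ⟨i, hi⟩] at h
    exact ⟨h.1, ⟨i, hi⟩, h.2.le⟩

theorem frontier_interior_hull (hc : t.card = 3) (ht : W.Indep t) :
    frontier (interior (W.hull t)) = frontier (W.hull t) := by
  rw [frontier, interior_interior, frontier,
    (W.convex_hull hc ht).closure_interior_eq_closure_of_nonempty_interior
      (W.interior_hull_nonempty hc ht)]

end

/-- The three corners of the triangulated triangle. -/
def corners : Finset V := Finset.univ.map ⟨W.out, W.out_injective⟩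

theorem card_corners : W.corners.card = 3 := by simp [corners]

theorem sum_smul_pos_of_support_corners {w : V → ℝ} (hw : ∀ v, v ∉ W.corners → w v = 0) (i : Fin 3) :
    (∑ v, w v • W.pos v) i = w (W.out i) := by
  rw [← Finset.sum_subset (Finset.subset_univ W.corners)
    fun v _ hv => by rw [hw v hv, zero_smul], corners, Finset.sum_map]
  simp [W.pos_out, Pi.single_apply]

/-- The corners sit at the unit vectors, so weights are read off as coordinates. The outer triangle
need not be in `tri`; this lets the lemmas on facets apply to it. -/
theorem indep_corners : W.Indep W.corners := by
  intro w w' _ _ h h' he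
  funext v
  by_cases hv : v ∈ W.corners
  · obtain ⟨i, rfl⟩ : ∃ i, W.out i = v := by simpa [corners] using hv
    have := congrFun he i
    rwa [W.sum_smul_pos_of_support_corners h, W.sum_smul_pos_of_support_corners h'] at this
  · rw [h v hv, h' v hv]

theorem hull_subset_bigTriangle {s : Set V} :
    W.hull s ⊆ {x | 0 ≤ x.1 ∧ 0 ≤ x.2 ∧ x.1 + x.2 ≤ 1} := by
  rintro x ⟨w, h0, h1, h2, rfl⟩
  simp only [Set.mem_ofPred_eq, Prod.fst_sum, Prod.snd_sum, point, Prod.smul_mk, smul_eq_mul]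
  refine ⟨Finset.sum_nonneg fun v _ => mul_nonneg (h0 v) (W.pos_nonneg v 0),
    Finset.sum_nonneg fun v _ => mul_nonneg (h0 v) (W.pos_nonneg v 1), ?_⟩
  rw [← Finset.sum_add_distrib, ← h2]
  refine Finset.sum_le_sum fun v _ => ?_
  have := W.pos_two v
  have := W.pos_nonneg v 2
  rw [← mul_add]
  exact mul_le_of_le_one_right (h0 v) (by linarith)

theorem hull_corners : W.hull W.corners = {x | 0 ≤ x.1 ∧ 0 ≤ x.2 ∧ x.1 + x.2 ≤ 1} := by
  refine Set.Subset.antisymm W.hull_subset_bigTriangle fun x ⟨h0, h1, h2⟩ => ?_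
  refine ⟨Function.extend W.out ![x.1, x.2, 1 - x.1 - x.2] 0, fun v => ?_, fun v hv => ?_, ?_, ?_⟩
  · by_cases hv : ∃ i, W.out i = v
    · obtain ⟨i, rfl⟩ := hv
      rw [W.out_injective.extend_apply]
      fin_cases i
      · exact h0
      · exact h1
      · simp only [Fin.reduceFinMk, Matrix.cons_val, Pi.zero_apply]
        linarith
    · rw [Function.extend_apply' _ _ _ hv]
  · rw [Function.extend_apply' _ _ _ (by simpa [corners] using hv)]
    rfl
  · have := sum_extend W.out_injective ![x.1, x.2, 1 - x.1 - x.2] (fun _ => (1 : ℝ))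
    simp only [smul_eq_mul, mul_one, Fin.sum_univ_three, Matrix.cons_val] at this
    rw [this]
    ring
  · rw [sum_extend W.out_injective]
    simp [Fin.sum_univ_three, point, W.pos_out, Pi.single_apply]

theorem hull_subset_hull_corners {s : Set V} : W.hull s ⊆ W.hull W.corners := by
  rw [hull_corners]
  exact W.hull_subset_bigTriangle

theorem isPreconnected_compl_hull_corners : IsPreconnected (W.hull W.corners)ᶜ := by
  have : (W.hull W.corners)ᶜ = {x : ℝ × ℝ | x.1 < 0} ∪ {x | 1 < x.1 + x.2} ∪ {x | x.2 < 0} := by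
    rw [hull_corners]
    ext x
    simp only [Set.mem_compl_iff, Set.mem_ofPred_eq, Set.mem_union, not_and_or, not_le]
    tauto
  rw [this]
  have h1 : IsLinearMap ℝ (fun x : ℝ × ℝ => x.1) := (LinearMap.fst ℝ ℝ ℝ).isLinear
  have h2 : IsLinearMap ℝ (fun x : ℝ × ℝ => x.2) := (LinearMap.snd ℝ ℝ ℝ).isLinear
  have h3 : IsLinearMap ℝ (fun x : ℝ × ℝ => x.1 + x.2) :=
    (LinearMap.fst ℝ ℝ ℝ + LinearMap.snd ℝ ℝ ℝ).isLinear
  -- The exterior is a union of three half-planes; each of the two points used lies in two of them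
  -- and so links them.
  refine IsPreconnected.union (-1, -1) (by simp) (by simp) ?_ (convex_halfSpace_lt h2 0).isPreconnected
  exact IsPreconnected.union (-1, 3) (by simp) (by norm_num) (convex_halfSpace_lt h1 0).isPreconnected
    (convex_halfSpace_gt h3 1).isPreconnected

theorem exists_mem_hull {x : ℝ × ℝ} (hx : x ∈ W.hull W.corners) : ∃ t ∈ W.tri, x ∈ W.hull t := by
  rw [hull_corners] at hx
  obtain ⟨h0, h1, h2⟩ := hx
  obtain ⟨t, ht, w, hw, hs, he⟩ := W.cover ![x.1, x.2, 1 - x.1 - x.2] (fun i => by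
    fin_cases i
    · exact h0
    · exact h1
    · simp only [Fin.reduceFinMk, Matrix.cons_val, Pi.zero_apply]; linarith)
  have e0 := congrFun he 0
  have e1 := congrFun he 1
  have e2 := congrFun he 2
  simp only [Finset.sum_apply, Pi.smul_apply, smul_eq_mul, Matrix.cons_val] at e0 e1 e2
  refine ⟨t, ht, w, hw, hs, ?_, ?_⟩
  · calc ∑ v, w v = ∑ v, w v * ∑ i, W.pos v i := by simp [W.sum_pos]
      _ = 1 := by
        simp only [Fin.sum_univ_three, mul_add, Finset.sum_add_distrib]
        rw [e0, e1, e2]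
        ring
  · ext
    · simpa [Prod.fst_sum, point] using e0
    · simpa [Prod.snd_sum, point] using e1

theorem hull_pair_subset_support {u v : V} (h : W.graph.Adj u v) :
    W.hull {u, v} ⊆ W.drawing.support := by
  rw [← W.drawing_arc h]
  exact (Set.subset_iUnion _ _).trans Set.subset_union_right

theorem support_subset {S : Set (ℝ × ℝ)} (h : ∀ u v t, t ∈ W.tri → u ∈ t → v ∈ t →
    W.hull {u, v} ⊆ S) : W.drawing.support ⊆ S := by
  refine Set.union_subset ?_ (Set.iUnion_subset ?_)
  · rintro x ⟨v, rfl⟩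
    obtain ⟨t, ht, hv⟩ := W.exists_mem_tri v
    exact h v v t ht hv hv (W.point_mem_hull (by simp))
  · rintro ⟨e, he⟩
    induction e using Sym2.ind with
    | _ u v =>
      rw [W.drawing_arc he]
      obtain ⟨-, t, ht, hu, hv⟩ := he
      exact h u v t ht hu hv

theorem frontier_triangle [DecidableEq V] {a b c : V} (hab : a ≠ b) (hac : a ≠ c) (hbc : b ≠ c)
    (h : W.Indep {a, b, c}) : frontier (W.hull ({a, b, c} : Finset V)) =
      W.hull {a, b} ∪ W.hull {b, c} ∪ W.hull {c, a} := by
  have h1 : ({a, b, c} : Finset V).erase a = {b, c} := by ext; simp; grind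
  have h2 : ({a, b, c} : Finset V).erase b = {c, a} := by ext; simp; grind
  have h3 : ({a, b, c} : Finset V).erase c = {a, b} := by ext; simp; grind
  rw [W.frontier_hull (by simp [hab, hac, hbc]) h]
  simp only [Finset.mem_insert, Finset.mem_singleton, Set.iUnion_iUnion_eq_or_left,
    Set.iUnion_iUnion_eq_left, h1, h2, h3, Finset.coe_pair]
  ext; simp only [Set.mem_union]; tauto

theorem frontier_hull_tri {t : Finset V} (hc : t.card = 3) (ht : W.Indep t)
    (h : ∀ u ∈ t, ∀ v ∈ t, ∃ s ∈ W.tri, u ∈ s ∧ v ∈ s) :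
    ∃ (a b c : V) (hab : W.graph.Adj a b) (hbc : W.graph.Adj b c) (hca : W.graph.Adj c a),
      frontier (W.hull t) = W.drawing.arc ⟨s(a, b), hab⟩ ∪ W.drawing.arc ⟨s(b, c), hbc⟩ ∪
        W.drawing.arc ⟨s(c, a), hca⟩ := by
  classical
  obtain ⟨a, b, c, hab, hac, hbc, rfl⟩ := Finset.card_eq_three.1 hc
  have h1 : W.graph.Adj a b := ⟨hab, h a (by simp) b (by simp)⟩
  have h2 : W.graph.Adj b c := ⟨hbc, h b (by simp) c (by simp)⟩
  have h3 : W.graph.Adj c a := ⟨hac.symm, h c (by simp) a (by simp)⟩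
  refine ⟨a, b, c, h1, h2, h3, ?_⟩
  rw [drawing_arc, drawing_arc, drawing_arc, W.frontier_triangle hab hac hbc ht]

theorem frontier_hull_subset_support {t : Finset V} (hc : t.card = 3) (ht : W.Indep t)
    (h : ∀ u ∈ t, ∀ v ∈ t, ∃ s ∈ W.tri, u ∈ s ∧ v ∈ s) :
    frontier (W.hull t) ⊆ W.drawing.support := by
  obtain ⟨a, b, c, hab, hbc, hca, he⟩ := W.frontier_hull_tri hc ht h
  rw [he, drawing_arc, drawing_arc, drawing_arc]
  exact Set.union_subset (Set.union_subset (W.hull_pair_subset_support hab)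
    (W.hull_pair_subset_support hbc)) (W.hull_pair_subset_support hca)

/-- An edge meets the facet in a simplex on at most two of its three vertices, where some
barycentric coordinate vanishes; in the interior all are positive. -/
theorem disjoint_interior_support {t : Finset V} (ht : t ∈ W.tri) :
    Disjoint (interior (W.hull t)) W.drawing.support := by
  classical
  have hc := W.card_tri t ht
  have hi := W.indep_of_mem ht
  refine (Set.subset_compl_iff_disjoint_left.1
    (W.support_subset fun u v t' ht' hu hv x hx hx' => ?_))
  have hx2 := W.hull_inter ht ht' subset_rfl (s' := {u, v})
    (by rintro y (rfl | rfl); exacts [hu, hv]) ⟨interior_subset hx', hx⟩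
  have hcard : (({u, v} : Finset V)).card < t.card := by
    rw [hc]
    exact Finset.card_le_two.trans_lt (by norm_num)
  obtain ⟨i, hi1, hi2⟩ := Finset.exists_mem_notMem_of_card_lt_card hcard
  have hx3 : x ∈ W.hull (t.erase i) := W.hull_mono (fun y hy => by
    refine Finset.mem_coe.2 (Finset.mem_erase.2 ⟨?_, hy.1⟩)
    rintro rfl
    exact hi2 (by simpa using hy.2)) hx2
  rw [W.interior_hull hc hi] at hx'
  rw [W.hull_erase_eq hc hi ⟨i, hi1⟩] at hx3
  exact (hx' ⟨i, hi1⟩).ne' hx3.2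

theorem tri_pair {t : Finset V} (ht : t ∈ W.tri) : ∀ u ∈ t, ∀ v ∈ t, ∃ s ∈ W.tri, u ∈ s ∧ v ∈ s :=
  fun _ hu _ hv => ⟨t, ht, hu, hv⟩

theorem corners_pair : ∀ u ∈ W.corners, ∀ v ∈ W.corners, ∃ s ∈ W.tri, u ∈ s ∧ v ∈ s := by
  simpa [corners] using W.out_edge

theorem connectedComponentIn_tri {t : Finset V} (ht : t ∈ W.tri) {x : ℝ × ℝ}
    (hx : x ∈ interior (W.hull t)) :
    connectedComponentIn W.drawing.supportᶜ x = interior (W.hull t) := by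
  have hc := W.card_tri t ht
  have hi := W.indep_of_mem ht
  refine connectedComponentIn_compl_eq isOpen_interior (W.convex_hull hc hi).interior.isPreconnected
    (W.disjoint_interior_support ht) ?_ hx
  rw [W.frontier_interior_hull hc hi]
  exact W.frontier_hull_subset_support hc hi (W.tri_pair ht)

theorem isFace_tri {t : Finset V} (ht : t ∈ W.tri) : W.drawing.IsFace (interior (W.hull t)) := by
  obtain ⟨x, hx⟩ := W.interior_hull_nonempty (W.card_tri t ht) (W.indep_of_mem ht)
  exact ⟨x, (W.disjoint_interior_support ht).subset_compl_right hx,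
    (W.connectedComponentIn_tri ht hx).symm⟩

theorem mem_of_incident {t : Finset V} (ht : t ∈ W.tri) {v : V}
    (h : W.drawing.Incident v (interior (W.hull t))) : v ∈ t := by
  have hc := W.card_tri t ht
  have hi := W.indep_of_mem ht
  rw [PlaneDrawing.Incident, W.frontier_interior_hull hc hi] at h
  exact W.mem_of_point_mem_hull ht subset_rfl ((W.isClosed_hull hc hi).frontier_subset h)

/-- A point of the big triangle lies in some facet, and off the drawing it can only be in that
facet's interior. The exterior of the big triangle is connected and accounts for the rest. -/
theorem isFace_cases {F : Set (ℝ × ℝ)} (hF : W.drawing.IsFace F) :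
    (∃ t ∈ W.tri, F = interior (W.hull t)) ∨ F = (W.hull W.corners)ᶜ := by
  obtain ⟨x, hx, rfl⟩ := hF
  by_cases hx' : x ∈ W.hull W.corners
  · obtain ⟨t, ht, hxt⟩ := W.exists_mem_hull hx'
    have hc := W.card_tri t ht
    have hi := W.indep_of_mem ht
    refine Or.inl ⟨t, ht, W.connectedComponentIn_tri ht ?_⟩
    by_contra hn
    refine hx (W.frontier_hull_subset_support hc hi (W.tri_pair ht) ?_)
    rw [(W.isClosed_hull hc hi).frontier_eq]
    exact ⟨hxt, hn⟩
  · right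
    refine connectedComponentIn_compl_eq
      (W.isClosed_hull W.card_corners W.indep_corners).isOpen_compl
      W.isPreconnected_compl_hull_corners ?_ ?_ hx'
    · exact (Set.subset_compl_iff_disjoint_right.1 (by
        rw [Set.compl_subset_compl]
        exact W.support_subset fun u v _ _ _ _ => W.hull_subset_hull_corners))
    · rw [frontier_compl]
      exact W.frontier_hull_subset_support W.card_corners W.indep_corners W.corners_pair

theorem isTriangulation_drawing : W.drawing.IsTriangulation := by
  intro F hF
  obtain ⟨t, ht, rfl⟩ | rfl := W.isFace_cases hF
  · have hc := W.card_tri t ht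
    have hi := W.indep_of_mem ht
    rw [W.frontier_interior_hull hc hi]
    exact W.frontier_hull_tri hc hi (W.tri_pair ht)
  · rw [frontier_compl]
    exact W.frontier_hull_tri W.card_corners W.indep_corners W.corners_pair

end Triangulation

/-! ### The tetrakis hexahedron and its convex lifting -/

namespace Gadget

/-- The vertices of the tetrakis hexahedron: `inl 0, inl 1, inl 2` span the outer facet and the
`inr i` the inner one. -/
abbrev Vert : Type := Fin 11 ⊕ Fin 3

/-- The colour class `0` consists of the vertices over the faces of the cube. -/
def color : Vert → Fin 3 := Sum.elim ![0, 1, 2, 0, 0, 0, 0, 2, 1, 2, 1] id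

/-- The three vertices of the facets different from the outer one; facet `22` is the inner one. -/
def facetVert : Fin 23 → Fin 3 → Vert := ![
  ![.inl 1, .inl 3, .inl 7], ![.inl 1, .inl 2, .inl 3], ![.inl 3, .inl 7, .inl 8],
  ![.inl 2, .inl 3, .inl 8], ![.inl 4, .inl 9, .inr 1], ![.inl 4, .inl 9, .inl 10],
  ![.inl 4, .inr 1, .inr 2], ![.inl 4, .inl 10, .inr 2], ![.inl 1, .inl 5, .inl 7],
  ![.inl 1, .inl 5, .inl 9], ![.inl 5, .inl 7, .inr 1], ![.inl 5, .inl 9, .inr 1],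
  ![.inl 2, .inl 6, .inl 8], ![.inl 2, .inl 6, .inl 10], ![.inl 6, .inl 8, .inr 2],
  ![.inl 6, .inl 10, .inr 2], ![.inl 0, .inl 1, .inl 9], ![.inl 0, .inl 2, .inl 10],
  ![.inl 0, .inl 9, .inl 10], ![.inl 7, .inl 8, .inr 0], ![.inl 7, .inr 0, .inr 1],
  ![.inl 8, .inr 0, .inr 2], ![.inr 0, .inr 1, .inr 2]]

/-- The facets different from the outer one. -/
def facet (t : Fin 23) : Finset Vert := Finset.univ.image (facetVert t)

/-- Homogeneous barycentric coordinates of the vertices with respect to the outer facet. -/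
def coord : Vert → Fin 3 → ℤ := Sum.elim ![
  ![1, 0, 0], ![0, 1, 0], ![0, 0, 1], ![2, 7, 7], ![22, 9, 9], ![12, 11, 5],
  ![12, 5, 11], ![8, 11, 8], ![8, 8, 11], ![10, 4, 1], ![10, 1, 4]] ![
  ![5, 4, 4], ![6, 4, 3], ![6, 3, 4]]

/-- Heights, in the same normalization as `coord`, of a convex lifting of the gadget. -/
def height : Vert → ℤ :=
  Sum.elim ![0, 0, 0, -12, -36, -24, -24, -24, -24, -12, -12] ![-12, -12, -12]

/-- The linear functional agreeing on the facet with `scale` times the height. -/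
def slope : Fin 23 → Fin 3 → ℤ := ![
  ![-9, 0, -6], ![-6, 0, 0], ![-54, -24, -24], ![-9, -6, 0], ![-9, -12, -18],
  ![-18, -48, -48], ![-18, -24, -24], ![-9, -18, -12], ![-9, 0, -12], ![-18, 0, -48],
  ![-54, -24, -72], ![-9, -6, -18], ![-9, -12, 0], ![-18, -48, 0], ![-54, -72, -24],
  ![-9, -18, -6], ![0, 0, -12], ![0, -12, 0], ![0, -12, -12], ![-36, -24, -24],
  ![-36, -24, -36], ![-36, -36, -24], ![-12, -12, -12]]

/-- See `slope`. -/
def scale : Fin 23 → ℤ := ![5, 1, 37, 5, 13, 35, 23, 13, 7, 19, 53, 11, 7, 19, 53, 11, 1, 1, 5, 31, 35, 35, 13]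

theorem facetVert_injective : ∀ t, Function.Injective (facetVert t) := by
  decide +kernel

theorem scale_pos : ∀ t, 0 < scale t := by decide +kernel

theorem coord_nonneg : ∀ v i, 0 ≤ coord v i := by decide +kernel

theorem sum_coord_pos : ∀ v, 0 < ∑ i, coord v i := by decide +kernel

theorem slope_eq : ∀ t, ∀ v ∈ facet t, ∑ i, slope t i * coord v i = scale t * height v := by
  decide +kernel

/-- With `slope_eq`, this says that the linear functional of each facet supports the lifted points
from below and touches exactly the facet's vertices. -/
theorem slope_lt : ∀ t, ∀ v ∉ facet t, ∑ i, slope t i * coord v i < scale t * height v := by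
  decide +kernel

theorem det_ne_zero : ∀ t, (Matrix.of fun i => coord (facetVert t i)).det ≠ 0 := by
  simp only [Matrix.det_fin_three, Matrix.of_apply]
  decide +kernel

/-- The edge opposite a vertex of a facet either lies on the boundary of the orthant or belongs to
another facet avoiding that vertex. `cover` needs this to cross the edge. -/
theorem opposite : ∀ t, ∀ i, (∃ j, 0 < coord (facetVert t i) j ∧
      ∀ i', i' ≠ i → coord (facetVert t i') j = 0) ∨
    ∃ t', facetVert t i ∉ facet t' ∧ ∀ i', i' ≠ i → facetVert t i' ∈ facet t' := by
  decide +kernel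

/-- Normalized barycentric coordinates. -/
noncomputable def pos (v : Vert) (i : Fin 3) : ℝ := coord v i / (∑ j, coord v j : ℤ)

noncomputable def lift (v : Vert) : ℝ := height v / (∑ j, coord v j : ℤ)

/-- The affine function agreeing with `lift` on a facet. -/
noncomputable def support (t : Fin 23) : (Fin 3 → ℝ) →ₗ[ℝ] ℝ :=
  ∑ i, (slope t i / scale t : ℝ) • LinearMap.proj i

theorem sum_coord_pos' (v : Vert) : (0 : ℝ) < (∑ j, coord v j : ℤ) := by
  exact_mod_cast sum_coord_pos v

theorem support_pos (t : Fin 23) (v : Vert) :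
    support t (pos v) = (∑ i, slope t i * coord v i : ℤ) / (scale t * (∑ j, coord v j : ℤ)) := by
  simp only [support, LinearMap.sum_apply, LinearMap.smul_apply, LinearMap.proj_apply, smul_eq_mul,
    pos, div_mul_div_comm, ← Finset.sum_div]
  push_cast
  rfl

theorem support_eq {t : Fin 23} {v : Vert} (h : v ∈ facet t) : support t (pos v) = lift v := by
  have hs : (scale t : ℝ) ≠ 0 := by exact_mod_cast (scale_pos t).ne'
  rw [support_pos, slope_eq t v h, lift]
  push_cast
  exact mul_div_mul_left _ _ hs

theorem support_lt {t : Fin 23} {v : Vert} (h : v ∉ facet t) : support t (pos v) < lift v := by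
  have := sum_coord_pos' v
  have hs : (0 : ℝ) < scale t := by exact_mod_cast scale_pos t
  have hlt : ((∑ i, slope t i * coord v i : ℤ) : ℝ) < scale t * height v := by
    exact_mod_cast slope_lt t v h
  rw [support_pos, lift, ← mul_div_mul_left (height v : ℝ) _ hs.ne']
  exact div_lt_div_of_pos_right hlt (mul_pos hs this)

theorem support_le (t : Fin 23) (v : Vert) : support t (pos v) ≤ lift v := by
  by_cases h : v ∈ facet t
  exacts [(support_eq h).le, (support_lt h).le]

/-- The matrix whose rows are the positions of the vertices of a facet. -/
noncomputable def posMatrix (t : Fin 23) : Matrix (Fin 3) (Fin 3) ℝ :=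
  Matrix.of fun i => pos (facetVert t i)

theorem det_posMatrix_ne_zero (t : Fin 23) : (posMatrix t).det ≠ 0 := by
  have h : posMatrix t = Matrix.of fun i j => ((∑ k, coord (facetVert t i) k : ℤ) : ℝ)⁻¹ *
      ((Matrix.of fun i => coord (facetVert t i)).map (Int.castRingHom ℝ)) i j := by
    ext i j
    simp [posMatrix, pos, div_eq_inv_mul]
  rw [h, Matrix.det_mul_column, ← RingHom.mapMatrix_apply, ← RingHom.map_det]
  refine mul_ne_zero (Finset.prod_ne_zero_iff.2 fun i _ => inv_ne_zero (sum_coord_pos' _).ne') ?_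
  simpa using det_ne_zero t

theorem sum_facet (t : Fin 23) {w : Vert → ℝ} (hw : ∀ v, v ∉ facet t → w v = 0) {M : Type*}
    [AddCommMonoid M] [Module ℝ M] (f : Vert → M) :
    ∑ v, w v • f v = ∑ i, w (facetVert t i) • f (facetVert t i) := by
  refine (Fintype.sum_of_injective _ (facetVert_injective t) _ _ (fun v hv => ?_)
    fun i => rfl).symm
  rw [hw v (by simpa [facet] using hv), zero_smul]

/-- For weights on a facet, the lifted height equals that facet's functional at the point and bounds
every other functional there. Two representations therefore have equal height, and equality makes
`w'` vanish off `t` as well. The nonzero determinant then identifies the weights. -/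
theorem unique {t t' : Fin 23} {w w' : Vert → ℝ} (h0 : 0 ≤ w) (h0' : 0 ≤ w')
    (hw : ∀ v, v ∉ facet t → w v = 0) (hw' : ∀ v, v ∉ facet t' → w' v = 0)
    (h : ∑ v, w v • pos v = ∑ v, w' v • pos v) : w = w' := by
  have key {s : Fin 23} {u : Vert → ℝ} (hu : ∀ v, v ∉ facet s → u v = 0) :
      support s (∑ v, u v • pos v) = ∑ v, u v * lift v := by
    rw [map_sum]
    refine Finset.sum_congr rfl fun v _ => ?_
    rw [map_smul, smul_eq_mul]
    by_cases hv : v ∈ facet s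
    · rw [support_eq hv]
    · rw [hu v hv, zero_mul, zero_mul]
  have le {s : Fin 23} {u : Vert → ℝ} (hu : 0 ≤ u) :
      support s (∑ v, u v • pos v) ≤ ∑ v, u v * lift v := by
    rw [map_sum]
    refine Finset.sum_le_sum fun v _ => ?_
    rw [map_smul, smul_eq_mul]
    exact mul_le_mul_of_nonneg_left (support_le s v) (hu v)
  have hle : ∑ v, w' v * lift v ≤ support t (∑ v, w' v • pos v) := by
    rw [← key hw', ← h, key hw]
    exact le h0
  have hw2 : ∀ v, v ∉ facet t → w' v = 0 := by
    rw [map_sum] at hle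
    have heq := (Finset.sum_eq_sum_iff_of_le (s := Finset.univ)
      (f := fun v => support t (w' v • pos v)) (g := fun v => w' v * lift v) fun v _ => by
        rw [map_smul, smul_eq_mul]
        exact mul_le_mul_of_nonneg_left (support_le t v) (h0' v)).1
      (le_antisymm (by rw [← map_sum]; exact le h0') hle)
    intro v hv
    have h1 := heq v (Finset.mem_univ v)
    rw [map_smul, smul_eq_mul] at h1
    by_contra hne
    exact (support_lt hv).ne (mul_left_cancel₀ hne h1)
  have h1 : (fun i => w (facetVert t i) - w' (facetVert t i)) = 0 := by
    refine Matrix.eq_zero_of_vecMul_eq_zero (det_posMatrix_ne_zero t) ?_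
    rw [Matrix.vecMul_eq_sum]
    simp only [sub_smul, Finset.sum_sub_distrib]
    rw [sub_eq_zero]
    exact (sum_facet t hw pos).symm.trans (h.trans (sum_facet t hw2 pos))
  funext v
  by_cases hv : v ∈ facet t
  · obtain ⟨i, -, rfl⟩ := Finset.mem_image.1 hv
    exact sub_eq_zero.1 (congrFun h1 i)
  · rw [hw v hv, hw2 v hv]

/-- Take the facet whose functional is largest at `x`. A negative coefficient of `x` there would
mean that `x` lies beyond the opposite edge: either outside the orthant, or where the functional of
the facet across is larger. -/
theorem cover {x : Fin 3 → ℝ} (hx : 0 ≤ x) : ∃ t, ∃ w : Vert → ℝ, 0 ≤ w ∧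
    (∀ v, v ∉ facet t → w v = 0) ∧ ∑ v, w v • pos v = x := by
  obtain ⟨t, ht⟩ := Finite.exists_max (fun t => support t x)
  let y : Fin 3 → ℝ := Matrix.vecMul x (posMatrix t)⁻¹
  have hy : ∑ i, y i • pos (facetVert t i) = x := by
    have : Matrix.vecMul y (posMatrix t) = x := by
      rw [Matrix.vecMul_vecMul, Matrix.nonsing_inv_mul _ (isUnit_iff_ne_zero.2
        (det_posMatrix_ne_zero t)), Matrix.vecMul_one]
    rwa [Matrix.vecMul_eq_sum] at this
  have hy0 : ∀ i, 0 ≤ y i := by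
    intro i
    by_contra hneg
    rw [not_le] at hneg
    obtain ⟨j, hj, hj'⟩ | ⟨t', ht', ht''⟩ := opposite t i
    · have h1 := congrFun hy j
      rw [Finset.sum_apply, Finset.sum_eq_single i (fun i' _ hi' => by simp [pos, hj' i' hi'])
        (by simp)] at h1
      have h2 : 0 < pos (facetVert t i) j :=
        div_pos (by exact_mod_cast hj) (sum_coord_pos' _)
      have h3 := mul_neg_of_neg_of_pos hneg h2
      exact (hx j).not_gt (h1 ▸ h3)
    · refine (ht t').not_gt ?_
      rw [← hy, map_sum, map_sum]
      refine Finset.sum_lt_sum (fun i' _ => ?_) ⟨i, Finset.mem_univ i, ?_⟩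
      · rw [map_smul, map_smul, smul_eq_mul, smul_eq_mul,
          support_eq (t := t) (Finset.mem_image_of_mem _ (Finset.mem_univ i'))]
        by_cases hi' : i' = i
        · rw [hi']
          exact mul_le_mul_of_nonpos_left (support_le _ _) hneg.le
        · rw [support_eq (ht'' i' hi')]
      · rw [map_smul, map_smul, smul_eq_mul, smul_eq_mul,
          support_eq (t := t) (Finset.mem_image_of_mem _ (Finset.mem_univ i))]
        exact mul_lt_mul_of_neg_left (support_lt ht') hneg
  refine ⟨t, Function.extend (facetVert t) y 0, fun v => ?_, fun v hv => ?_, ?_⟩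
  · by_cases hv : ∃ i, facetVert t i = v
    · obtain ⟨i, rfl⟩ := hv
      rw [(facetVert_injective t).extend_apply]
      exact hy0 i
    · rw [Function.extend_apply' _ _ _ hv]
  · rw [Function.extend_apply' _ _ _ (by simpa [facet] using hv)]
    rfl
  · rw [Triangulation.sum_extend (facetVert_injective t), hy]

theorem pos_nonneg (v : Vert) (i : Fin 3) : 0 ≤ pos v i :=
  div_nonneg (by exact_mod_cast coord_nonneg v i) (sum_coord_pos' v).le

theorem sum_pos (v : Vert) : ∑ i, pos v i = 1 := by
  simp only [pos, ← Finset.sum_div, ← Int.cast_sum]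
  exact div_self (sum_coord_pos' v).ne'

end Gadget

/-! ### Degree count and restriction for induced trees -/

theorem SimpleGraph.IsTree.sum_card_neighbors_add_two {V : Type*} [Fintype V] [DecidableEq V]
    {G : SimpleGraph V} [DecidableRel G.Adj] {S : Finset V} (h : (G.induce (S : Set V)).IsTree) :
    ∑ x ∈ S, {y ∈ S | G.Adj x y}.card + 2 = 2 * S.card := by
  have h1 := h.card_edgeFinset
  have h2 := (G.induce (S : Set V)).sum_degrees_eq_twice_card_edges
  have h3 : ∀ x : (S : Set V), (G.induce (S : Set V)).degree x = {y ∈ S | G.Adj x y}.card := by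
    intro x
    rw [← SimpleGraph.card_neighborFinset_eq_degree, ← Finset.card_map (Function.Embedding.subtype _)]
    congr 1
    ext y
    simp [and_comm]
  have h4 : ∑ x : (S : Set V), (G.induce (S : Set V)).degree x =
      ∑ x ∈ S, {y ∈ S | G.Adj x y}.card := by
    rw [← Finset.sum_coe_sort S]
    exact Finset.sum_congr rfl fun x _ => h3 x
  have h5 : Fintype.card (S : Set V) = S.card := by simp
  rw [h5] at h1
  rw [← h4]
  omega

/-- An induced tree restricts to an induced tree on a part of the graph whose boundary `S` is a
clique. -/
theorem SimpleGraph.IsTree.induce_preimage {V V' : Type*} {G : SimpleGraph V} {G' : SimpleGraph V'}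
    (f : G ↪g G') {S : Set V} (hS : ∀ u ∈ S, ∀ v ∈ S, u ≠ v → G.Adj u v)
    (hf : ∀ u w, w ∉ Set.range f → G'.Adj (f u) w → u ∈ S) {T : Set V'}
    (hT : (G'.induce T).IsTree) (hne : (f ⁻¹' T).Nonempty) : (G.induce (f ⁻¹' T)).IsTree := by
  have := hne.to_subtype
  refine { preconnected := fun x y => ?_, isAcyclic := ?_ }
  -- Follow a walk in `T` from `x`. While it is outside the part, remember a vertex of `S` already
  -- reached inside; the walk re-enters through `S`, and since `S` is a clique the excursion is
  -- replaced by at most one edge.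
  · have key : ∀ z : T, (G'.induce T).Reachable ⟨f x, x.2⟩ z →
        (∀ y : f ⁻¹' T, f y = z → (G.induce (f ⁻¹' T)).Reachable x y) ∧
        ((z : V') ∉ Set.range f →
          ∃ s : f ⁻¹' T, (s : V) ∈ S ∧ (G.induce (f ⁻¹' T)).Reachable x s) := by
      intro z hz
      rw [SimpleGraph.reachable_iff_reflTransGen] at hz
      induction hz with
      | refl =>
        refine ⟨fun y hy => ?_, fun h => (h ⟨x, rfl⟩).elim⟩
        rw [Subtype.ext (f.injective hy)]
      | @tail z z' _ hzz ih =>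
        have hadj : G'.Adj z z' := hzz
        refine ⟨fun y hy => ?_, fun h => ?_⟩
        · by_cases hz : (z : V') ∈ Set.range f
          · obtain ⟨u, hu⟩ := hz
            refine (ih.1 ⟨u, by rw [Set.mem_preimage, hu]; exact z.2⟩ hu).trans
              (SimpleGraph.Adj.reachable ?_)
            rw [← hu, ← hy, f.map_adj_iff] at hadj
            exact hadj
          · obtain ⟨s, hs, hr⟩ := ih.2 hz
            have hy' : (y : V) ∈ S := hf y z hz (by rw [hy]; exact hadj.symm)
            by_cases hsy : (s : V) = y
            · rwa [← Subtype.ext hsy]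
            · exact hr.trans (SimpleGraph.Adj.reachable (hS s hs y hy' hsy))
        · by_cases hz : (z : V') ∈ Set.range f
          · obtain ⟨u, hu⟩ := hz
            have hu' : f u ∈ T := by rw [hu]; exact z.2
            exact ⟨⟨u, hu'⟩, hf u z' h (by rw [hu]; exact hadj), ih.1 ⟨u, hu'⟩ hu⟩
          · exact ih.2 hz
    exact (key ⟨f y, y.2⟩ (hT.connected.preconnected _ _)).1 y rfl
  · refine hT.isAcyclic.comap (G := G.induce (f ⁻¹' T))
      ⟨fun x => ⟨f x, x.2⟩, fun h => f.map_adj_iff.2 h⟩ fun x y h => ?_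
    exact Subtype.ext (f.injective (congrArg Subtype.val h))

theorem SimpleGraph.IsAcyclic.not_triangle {V : Type*} {G : SimpleGraph V} {T : Set V}
    (h : (G.induce T).IsAcyclic) {a b c : V} (ha : a ∈ T) (hb : b ∈ T) (hc : c ∈ T)
    (hab : G.Adj a b) (hac : G.Adj a c) (hbc : G.Adj b c) : False := by
  classical
  refine h.cliqueFree (n := 3) le_rfl {⟨a, ha⟩, ⟨b, hb⟩, ⟨c, hc⟩} ?_
  exact SimpleGraph.is3Clique_triple_iff.2 ⟨hab, hac, hbc⟩

/-! ### Trees on the gadget contain and omit apices -/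

namespace Gadget

/-- The graph of the tetrakis hexahedron. -/
abbrev graph : SimpleGraph Vert := facetGraph (Set.range facet)

theorem graph_adj {x y : Vert} : graph.Adj x y ↔ x ≠ y ∧ ∃ t, x ∈ facet t ∧ y ∈ facet t := by
  simp [graph, facetGraph]

instance : DecidableRel graph.Adj := fun _ _ => decidable_of_iff' _ graph_adj

/-- The vertices of the cube. -/
def cube : Finset Vert := {x | color x ≠ 0}

/-- The vertices over the faces of the cube. -/
def apices : Finset Vert := {x | color x = 0}

theorem card_cube : cube.card = 8 := by decide +kernel

theorem card_apices : apices.card = 6 := by decide +kernel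

theorem card_cube_neighbors : ∀ x ∈ cube, {y ∈ cube | graph.Adj x y}.card = 3 := by
  decide +kernel

theorem card_apex_neighbors : ∀ x ∈ cube, {y ∈ apices | graph.Adj x y}.card = 3 := by
  decide +kernel

theorem not_adj_apices : ∀ x ∈ apices, ∀ y ∈ apices, ¬ graph.Adj x y := by decide +kernel

/-- Used to turn hitting facets into covering cube edges when the tree has no apex; the inner facet
is avoided because the tree need not hit it. -/
theorem exists_facet_of_adj : ∀ x ∈ cube, ∀ y ∈ cube, graph.Adj x y →
    ∃ t ≠ 22, ∀ z ∈ facet t, z = x ∨ z = y ∨ z ∈ apices := by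
  decide +kernel

theorem exists_apex_of_adj : ∀ x ∈ cube, ∀ y ∈ cube, graph.Adj x y →
    ∃ z ∈ apices, graph.Adj x z ∧ graph.Adj y z := by
  decide +kernel

theorem mem_cube {x : Vert} : x ∈ cube ↔ color x ≠ 0 := by simp [cube]

theorem mem_apices {x : Vert} : x ∈ apices ↔ color x = 0 := by simp [apices]

theorem sum_neighbors_comm (S K : Finset Vert) : ∑ x ∈ S, {y ∈ K | graph.Adj x y}.card =
    ∑ y ∈ K, {x ∈ S | graph.Adj y x}.card := by
  refine (Finset.sum_card_bipartiteAbove_eq_sum_card_bipartiteBelow _).trans ?_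
  refine Finset.sum_congr rfl fun y _ => congrArg Finset.card ?_
  ext x
  simp [Finset.bipartiteBelow, graph.adj_comm]

theorem exists_mem_color_zero {T : Set Vert} (hT : (graph.induce T).IsTree)
    (hit : ∀ t ≠ 22, ∃ x ∈ T, x ∈ facet t) : ∃ x ∈ T, color x = 0 := by
  classical
  by_contra! hcon
  obtain ⟨S, rfl⟩ : ∃ S : Finset Vert, (S : Set Vert) = T := ⟨T.toFinset, by simp⟩
  have hsum := hT.sum_card_neighbors_add_two
  have hS : S ⊆ cube := fun x hx => mem_cube.2 (hcon x hx)
  have hind : ∀ x ∈ cube \ S, ∀ y ∈ cube, graph.Adj x y → y ∈ S := by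
    intro x hx y hy hxy
    by_contra hyS
    obtain ⟨hx1, hx2⟩ := Finset.mem_sdiff.1 hx
    obtain ⟨t, ht, h⟩ := exists_facet_of_adj x hx1 y hy hxy
    obtain ⟨z, hz, hzt⟩ := hit t ht
    rcases h z hzt with rfl | rfl | hz'
    · exact hx2 hz
    · exact hyS hz
    · exact hcon z hz (mem_apices.1 hz')
  have h1 : ∑ x ∈ S, {y ∈ S | graph.Adj x y}.card +
      ∑ x ∈ S, {y ∈ cube \ S | graph.Adj x y}.card = 3 * S.card := by
    rw [← Finset.sum_add_distrib, Finset.sum_congr rfl (g := fun _ => 3), Finset.sum_const,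
      smul_eq_mul, mul_comm]
    intro x hx
    refine Eq.trans ?_ (card_cube_neighbors x (hS hx))
    rw [← Finset.card_union_of_disjoint, ← Finset.filter_union, Finset.union_sdiff_of_subset hS]
    exact Finset.disjoint_filter_filter Finset.disjoint_sdiff
  have h2 : ∑ x ∈ S, {y ∈ cube \ S | graph.Adj x y}.card = 3 * (cube \ S).card := by
    rw [sum_neighbors_comm, Finset.sum_congr rfl (g := fun _ => 3), Finset.sum_const,
      smul_eq_mul, mul_comm]
    intro x hx
    refine Eq.trans (congrArg Finset.card ?_) (card_cube_neighbors x (Finset.mem_sdiff.1 hx).1)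
    ext y
    simp only [Finset.mem_filter]
    exact ⟨fun h => ⟨hS h.1, h.2⟩, fun h => ⟨hind x hx y h.1 h.2, h.2⟩⟩
  have h3 := Finset.card_sdiff_add_card_eq_card hS
  rw [card_cube] at h3
  -- With s the size of `S`, the equations combine to (2s - 2) + 3(8 - s) = 3s, that is, 4s = 22.
  omega

theorem exists_notMem_color_zero {T : Set Vert} (hT : (graph.induce T).IsTree) :
    ∃ x ∉ T, color x = 0 := by
  classical
  by_contra! hcon
  obtain ⟨S, rfl⟩ : ∃ S : Finset Vert, (S : Set Vert) = T := ⟨T.toFinset, by simp⟩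
  have hsum := hT.sum_card_neighbors_add_two
  have hA : apices ⊆ S := fun x hx => by
    by_contra h
    exact hcon x h (mem_apices.1 hx)
  set J := S \ apices with hJ
  have hJc : ∀ x ∈ J, x ∈ cube := fun x hx =>
    mem_cube.2 fun h => (Finset.mem_sdiff.1 hx).2 (mem_apices.2 h)
  have h1 : ∀ x ∈ J, {y ∈ S | graph.Adj x y}.card = 3 := by
    intro x hx
    refine Eq.trans (congrArg Finset.card ?_) (card_apex_neighbors x (hJc x hx))
    ext y
    simp only [Finset.mem_filter]
    refine ⟨fun ⟨hy, hxy⟩ => ⟨?_, hxy⟩, fun h => ⟨hA h.1, h.2⟩⟩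
    by_contra hyA
    obtain ⟨z, hz, hxz, hyz⟩ := exists_apex_of_adj x (hJc x hx) y
      (hJc y (Finset.mem_sdiff.2 ⟨hy, hyA⟩)) hxy
    exact hT.isAcyclic.not_triangle (Finset.mem_sdiff.1 hx).1 hy (hA hz) hxy hxz hyz
  have h2 : ∑ x ∈ apices, {y ∈ S | graph.Adj x y}.card = 3 * J.card := by
    have : ∀ x ∈ apices, {y ∈ S | graph.Adj x y}.card = {y ∈ J | graph.Adj x y}.card := by
      intro x hx
      congr 1
      ext y
      simp only [Finset.mem_filter, hJ, Finset.mem_sdiff]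
      exact ⟨fun h => ⟨⟨h.1, fun hy => not_adj_apices x hx y hy h.2⟩, h.2⟩,
        fun h => ⟨h.1.1, h.2⟩⟩
    rw [Finset.sum_congr rfl this, sum_neighbors_comm, Finset.sum_congr rfl
      fun x hx => card_apex_neighbors x (hJc x hx), Finset.sum_const, smul_eq_mul, mul_comm]
  rw [← Finset.sum_sdiff hA, h2, Finset.sum_congr rfl h1, Finset.sum_const, smul_eq_mul] at hsum
  have h3 := Finset.card_sdiff_add_card_eq_card hA
  rw [card_apices, ← hJ] at h3
  -- With j the size of `J`, the equations combine to 6j + 2 = 2(j + 6), that is, 4j = 10.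
  omega

end Gadget

/-! ### Finite checks needed for gluing -/

namespace Gadget

/-- Removing the inner facet destroys no adjacency at a vertex outside it. -/
theorem exists_facet_inl : ∀ (x : Fin 11) (y : Vert), (∃ t, .inl x ∈ facet t ∧ y ∈ facet t) →
    ∃ t ≠ 22, .inl x ∈ facet t ∧ y ∈ facet t := by
  decide +kernel

theorem exists_facet_inl_self : ∀ x : Fin 11, ∃ t ≠ 22, .inl x ∈ facet t := by decide +kernel

/-- The corners of the outer facet. -/
def outer (i : Fin 3) : Fin 11 := Fin.castLE (by decide) i

theorem exists_facet_outer : ∀ i j, ∃ t ≠ 22, .inl (outer i) ∈ facet t ∧ .inl (outer j) ∈ facet t := by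
  decide +kernel

theorem color_outer : ∀ i, color (.inl (outer i)) = i := by decide +kernel

theorem color_injOn_facet : ∀ t, ∀ x ∈ facet t, ∀ y ∈ facet t, color x = color y → x = y := by
  decide +kernel

theorem inr_mem_facet_pair : ∀ t ≠ 22, ∃ i j, ∀ l, .inr l ∈ facet t → l = i ∨ l = j := by
  decide +kernel

theorem mem_inner_facet : ∀ x : Vert, x ∈ facet 22 ↔ ∃ i, x = .inr i := by decide +kernel

theorem card_facet (t : Fin 23) : (facet t).card = 3 := by
  rw [facet, Finset.card_image_of_injective _ (facetVert_injective t)]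
  rfl

theorem coord_outer : ∀ i j, coord (.inl (outer i)) j = if j = i then 1 else 0 := by
  decide +kernel

theorem pos_outer (i : Fin 3) : pos (.inl (outer i)) = Pi.single i 1 := by
  funext j
  simp [pos, coord_outer, Pi.single_apply]

theorem even_card_neighbors : ∀ x : Fin 11, Even ({y | graph.Adj (.inl x) y} : Finset Vert).card := by
  decide +kernel

theorem even_card_inl_neighbors :
    ∀ i : Fin 3, Even ({x | graph.Adj (.inr i) (.inl x)} : Finset (Fin 11)).card := by
  decide +kernel

theorem adj_inr : ∀ i j : Fin 3, graph.Adj (.inr i) (.inr j) ↔ i ≠ j := by decide +kernel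

end Gadget

/-! ### Gluing into the gadget, and shifting colours -/

namespace Triangulation

variable {V : Type} [Fintype V] (W : Triangulation V)

/-- The embedding of the gadget whose inner facet is the boundary of a given triangulation. -/
def emb : Gadget.Vert ↪ Fin 11 ⊕ V :=
  ⟨Sum.map id W.out, Sum.map_injective.2 ⟨Function.injective_id, W.out_injective⟩⟩

@[simp] theorem emb_inl (x : Fin 11) : W.emb (.inl x) = .inl x := rfl

@[simp] theorem emb_inr (i : Fin 3) : W.emb (.inr i) = .inr (W.out i) := rfl

/-- The facets of the triangulation obtained by surrounding a given one with the gadget. -/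
def glueTri : Set (Finset (Fin 11 ⊕ V)) :=
  {s | (∃ t ≠ 22, s = (Gadget.facet t).map W.emb) ∨ ∃ t ∈ W.tri, s = t.map .inr}

theorem facet_mem_glueTri {t : Fin 23} (ht : t ≠ 22) : (Gadget.facet t).map W.emb ∈ W.glueTri :=
  Or.inl ⟨t, ht, rfl⟩

theorem tri_mem_glueTri {t : Finset V} (ht : t ∈ W.tri) : t.map .inr ∈ W.glueTri :=
  Or.inr ⟨t, ht, rfl⟩

/-- The positions of the vertices when a triangulation is put into the inner facet. -/
noncomputable def gluePos : Fin 11 ⊕ V → Fin 3 → ℝ :=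
  Sum.elim (fun x => Gadget.pos (.inl x)) fun v => ∑ i, W.pos v i • Gadget.pos (.inr i)

theorem gluePos_emb (x : Gadget.Vert) : W.gluePos (W.emb x) = Gadget.pos x := by
  cases x with
  | inl x => rfl
  | inr i => simp [gluePos, W.pos_out, Pi.single_apply]

/-- The weights on the gadget that result from moving weights inside the inner facet to its
corners. -/
noncomputable def collapse (w : Fin 11 ⊕ V → ℝ) : Gadget.Vert → ℝ :=
  Sum.elim (fun x => w (.inl x)) fun i => ∑ v, w (.inr v) * W.pos v i

theorem sum_collapse (w : Fin 11 ⊕ V → ℝ) :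
    ∑ x, W.collapse w x • Gadget.pos x = ∑ x, w x • W.gluePos x := by
  rw [Fintype.sum_sum_type, Fintype.sum_sum_type]
  congr 1
  simp only [collapse, gluePos, Sum.elim_inr, Finset.sum_smul, Finset.smul_sum, smul_smul]
  exact Finset.sum_comm

theorem collapse_nonneg {w : Fin 11 ⊕ V → ℝ} (hw : 0 ≤ w) : 0 ≤ W.collapse w := by
  rintro (x | i)
  · exact hw _
  · exact Finset.sum_nonneg fun v _ => mul_nonneg (hw _) (W.pos_nonneg v i)

theorem collapse_support {s : Finset (Fin 11 ⊕ V)} (hs : s ∈ W.glueTri) {w : Fin 11 ⊕ V → ℝ}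
    (hw : ∀ v, v ∉ s → w v = 0) : (∃ t, ∀ x, x ∉ Gadget.facet t → W.collapse w x = 0) ∧
      ∃ t ∈ W.tri, ∀ v, v ∉ t → w (.inr v) = 0 := by
  obtain ⟨t, ht, rfl⟩ | ⟨t, ht, rfl⟩ := hs
  · have hw' : ∀ v, (∀ i, .inr i ∈ Gadget.facet t → W.out i ≠ v) → w (.inr v) = 0 := by
      intro v hv
      refine hw _ fun hmem => ?_
      obtain ⟨x | i, hx, hxv⟩ := Finset.mem_map.1 hmem
      · simp at hxv
      · exact hv i hx (Sum.inr_injective hxv)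
    refine ⟨⟨t, ?_⟩, ?_⟩
    · rintro (x | i) hx
      · exact hw _ fun hmem => hx ((Finset.mem_map' W.emb (a := .inl x)).1 hmem)
      · refine Finset.sum_eq_zero fun v _ => ?_
        by_cases hv : ∃ j, .inr j ∈ Gadget.facet t ∧ W.out j = v
        · obtain ⟨j, hj, rfl⟩ := hv
          have : i ≠ j := by
            rintro rfl
            exact hx hj
          rw [W.pos_out, Pi.single_eq_of_ne this, mul_zero]
        · rw [hw' v (by simpa using hv), zero_mul]
    -- A gadget facet touches the inner one in at most two corners, and some facet of `W` contains
    -- both.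
    · obtain ⟨i, j, hij⟩ := Gadget.inr_mem_facet_pair t ht
      obtain ⟨s, hs, hi, hj⟩ := W.out_edge i j
      refine ⟨s, hs, fun v hv => hw' v ?_⟩
      rintro l hl rfl
      rcases hij l hl with rfl | rfl
      exacts [hv hi, hv hj]
  · refine ⟨⟨22, ?_⟩, t, ht, fun v hv => hw _ fun hmem => hv ?_⟩
    · rintro (x | i) hx
      · exact hw _ fun hmem => by simp at hmem
      · exact (hx ((Gadget.mem_inner_facet _).2 ⟨i, rfl⟩)).elim
    · simpa using hmem

/-- After collapsing, uniqueness in the gadget gives equality on the outer vertices and of the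
weighted sums at the inner corners. The latter are an instance of uniqueness in `W`, where weights
of arbitrary total are allowed. -/
theorem glue_unique {t t' : Finset (Fin 11 ⊕ V)} (ht : t ∈ W.glueTri) (ht' : t' ∈ W.glueTri)
    {w w' : Fin 11 ⊕ V → ℝ} (h0 : 0 ≤ w) (h0' : 0 ≤ w') (hw : ∀ v, v ∉ t → w v = 0)
    (hw' : ∀ v, v ∉ t' → w' v = 0) (h : ∑ v, w v • W.gluePos v = ∑ v, w' v • W.gluePos v) :
    w = w' := by
  obtain ⟨⟨s, hs⟩, u, hu, hu1⟩ := W.collapse_support ht hw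
  obtain ⟨⟨s', hs'⟩, u', hu', hu1'⟩ := W.collapse_support ht' hw'
  have key := Gadget.unique (W.collapse_nonneg h0) (W.collapse_nonneg h0') hs hs'
    (by rw [sum_collapse, sum_collapse, h])
  have hr := W.unique u hu u' hu' (fun v => w (.inr v)) (fun v => w' (.inr v)) (fun v => h0 _)
    (fun v => h0' _) hu1 hu1' (by
      funext i
      simpa [collapse] using congrFun key (.inr i))
  funext x
  cases x with
  | inl x => exact congrFun key (.inl x)
  | inr v => exact congrFun hr v

theorem glue_cover {x : Fin 3 → ℝ} (hx : 0 ≤ x) : ∃ t ∈ W.glueTri, ∃ w : Fin 11 ⊕ V → ℝ,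
    0 ≤ w ∧ (∀ v, v ∉ t → w v = 0) ∧ ∑ v, w v • W.gluePos v = x := by
  obtain ⟨t, w, h0, hw, hs⟩ := Gadget.cover hx
  by_cases ht : t = 22
  · subst ht
    obtain ⟨s, hs1, u, hu0, hu, hus⟩ := W.cover (fun i => w (.inr i)) fun i => h0 _
    have hc : W.collapse (Sum.elim 0 u) = w := by
      funext y
      cases y with
      | inl y => exact (hw _ (by simp [Gadget.mem_inner_facet])).symm
      | inr i => simpa [collapse] using congrFun hus i
    refine ⟨_, W.tri_mem_glueTri hs1, Sum.elim 0 u, ?_, ?_, ?_⟩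
    · rintro (y | v)
      exacts [le_rfl, hu0 v]
    · rintro (y | v) hv
      exacts [rfl, hu v (by simpa using hv)]
    · rw [← sum_collapse, hc, hs]
  · refine ⟨_, W.facet_mem_glueTri ht, Function.extend W.emb w 0, fun v => ?_, fun v hv => ?_, ?_⟩
    · by_cases hv : ∃ y, W.emb y = v
      · obtain ⟨y, rfl⟩ := hv
        rw [W.emb.injective.extend_apply]
        exact h0 y
      · rw [Function.extend_apply' _ _ _ hv]
    · by_cases hv' : ∃ y, W.emb y = v
      · obtain ⟨y, rfl⟩ := hv'
        rw [W.emb.injective.extend_apply]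
        exact hw y fun hy => hv (Finset.mem_map_of_mem _ hy)
      · rw [Function.extend_apply' _ _ _ hv']
        rfl
    · rw [sum_extend W.emb.injective]
      simpa only [gluePos_emb] using hs

theorem out_adj {i j : Fin 3} (h : i ≠ j) : W.graph.Adj (W.out i) (W.out j) :=
  ⟨W.out_injective.ne h, W.out_edge i j⟩

theorem glue_adj_inr {u v : V} : (facetGraph W.glueTri).Adj (.inr u) (.inr v) ↔ W.graph.Adj u v := by
  constructor
  · rintro ⟨hne, s, ⟨t, ht, rfl⟩ | ⟨t, ht, rfl⟩, hu, hv⟩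
    · obtain ⟨x | i, hi, hiu⟩ := Finset.mem_map.1 hu
      · simp at hiu
      obtain ⟨x | j, hj, hjv⟩ := Finset.mem_map.1 hv
      · simp at hjv
      obtain rfl : W.out i = u := Sum.inr_injective hiu
      obtain rfl : W.out j = v := Sum.inr_injective hjv
      exact W.out_adj fun h => hne (by rw [h])
    · exact ⟨fun h => hne (congrArg _ h), t, ht, by simpa using hu, by simpa using hv⟩
  · rintro ⟨hne, t, ht, hu, hv⟩
    exact ⟨fun h => hne (Sum.inr_injective h), _, W.tri_mem_glueTri ht,
      Finset.mem_map_of_mem _ hu, Finset.mem_map_of_mem _ hv⟩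

theorem glue_adj_inl {x : Fin 11} {z : Fin 11 ⊕ V} : (facetGraph W.glueTri).Adj (.inl x) z ↔
    ∃ y, W.emb y = z ∧ Gadget.graph.Adj (.inl x) y := by
  simp only [Gadget.graph_adj]
  constructor
  · rintro ⟨hne, s, ⟨t, ht, rfl⟩ | ⟨t, ht, rfl⟩, hx, hz⟩
    · obtain ⟨y, hy, rfl⟩ := Finset.mem_map.1 hz
      refine ⟨y, rfl, ?_, t, (Finset.mem_map' W.emb (a := .inl x)).1 hx, hy⟩
      rintro rfl
      exact hne rfl
    · simp at hx
  · rintro ⟨y, rfl, hne, h⟩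
    obtain ⟨t, ht, hx, hy⟩ := Gadget.exists_facet_inl x y h
    exact ⟨fun h => hne (W.emb.injective h), _, W.facet_mem_glueTri ht,
      Finset.mem_map_of_mem W.emb hx, Finset.mem_map_of_mem W.emb hy⟩

theorem glue_adj_emb {x y : Gadget.Vert} :
    (facetGraph W.glueTri).Adj (W.emb x) (W.emb y) ↔ Gadget.graph.Adj x y := by
  have key (x : Fin 11) (y : Gadget.Vert) :
      (facetGraph W.glueTri).Adj (.inl x) (W.emb y) ↔ Gadget.graph.Adj (.inl x) y := by
    rw [glue_adj_inl]
    refine ⟨?_, fun h => ⟨y, rfl, h⟩⟩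
    rintro ⟨y', hy', h⟩
    rwa [← W.emb.injective hy']
  match x, y with
  | .inl x, y => exact key x y
  | .inr i, .inl x => rw [SimpleGraph.adj_comm, Gadget.graph.adj_comm]; exact key x _
  | .inr i, .inr j =>
    rw [emb_inr, emb_inr, glue_adj_inr, Gadget.adj_inr]
    exact ⟨fun h hij => h.1 (by rw [hij]), W.out_adj⟩

/-- The gadget as an induced subgraph. -/
def embGraph : Gadget.graph ↪g facetGraph W.glueTri := ⟨W.emb, W.glue_adj_emb⟩

/-- The inner triangulation as an induced subgraph. -/
def inrGraph : W.graph ↪g facetGraph W.glueTri := ⟨.inr, W.glue_adj_inr⟩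

/-- A corner of `W` keeps its even degree in `W` and gains its gadget neighbours outside the inner
facet, whose number is again even. -/
theorem even_degree_glue (z : Fin 11 ⊕ V) : Even ((facetGraph W.glueTri).neighborSet z).ncard := by
  classical
  cases z with
  | inl x =>
    have : (facetGraph W.glueTri).neighborSet (.inl x) =
        W.emb '' (({y | Gadget.graph.Adj (.inl x) y} : Finset Gadget.Vert) : Set Gadget.Vert) := by
      ext z
      rw [SimpleGraph.mem_neighborSet, glue_adj_inl]
      simp [and_comm]
    rw [this, Set.ncard_image_of_injective _ W.emb.injective, Set.ncard_coe_finset]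
    exact Gadget.even_card_neighbors x
  | inr v =>
    have : (facetGraph W.glueTri).neighborSet (.inr v) = Sum.inr '' W.graph.neighborSet v ∪
        Sum.inl '' {x | ∃ i, W.out i = v ∧ Gadget.graph.Adj (.inr i) (.inl x)} := by
      ext z
      rw [SimpleGraph.mem_neighborSet]
      cases z with
      | inl x =>
        rw [SimpleGraph.adj_comm, glue_adj_inl]
        simp only [Set.mem_union, Set.mem_image, reduceCtorEq, and_false, exists_false, false_or,
          Set.mem_ofPred_eq, Sum.inl.injEq, exists_eq_right, Sum.exists, emb_inl, emb_inr,
          false_and, Sum.inr.injEq, Gadget.graph.adj_comm (.inl x)]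
      | inr u => simp [glue_adj_inr]
    rw [this, Set.ncard_union_eq (by simp [Set.disjoint_left]),
      Set.ncard_image_of_injective _ Sum.inr_injective,
      Set.ncard_image_of_injective _ Sum.inl_injective]
    refine (W.even_degree v).add ?_
    by_cases hv : ∃ i, W.out i = v
    · obtain ⟨i, rfl⟩ := hv
      have : {x | ∃ j, W.out j = W.out i ∧ Gadget.graph.Adj (.inr j) (.inl x)} =
          (({x | Gadget.graph.Adj (.inr i) (.inl x)} : Finset (Fin 11)) : Set (Fin 11)) := by
        ext x
        simp [W.out_injective.eq_iff]
      rw [this, Set.ncard_coe_finset]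
      exact Gadget.even_card_inl_neighbors i
    · have : {x | ∃ j, W.out j = v ∧ Gadget.graph.Adj (.inr j) (.inl x)} = (∅ : Set (Fin 11)) := by
        ext x
        simp only [Set.mem_ofPred_eq, Set.mem_empty_iff_false, iff_false]
        rintro ⟨j, hj, -⟩
        exact hv ⟨j, hj⟩
      simp [this]

/-- The triangulation obtained by putting a given one into the inner facet of the gadget. -/
noncomputable def glue : Triangulation (Fin 11 ⊕ V) where
  tri := W.glueTri
  pos := W.gluePos
  out i := .inl (Gadget.outer i)
  color := Sum.elim (fun x => Gadget.color (.inl x)) W.color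
  card_tri := by
    rintro s (⟨t, -, rfl⟩ | ⟨t, ht, rfl⟩)
    · rw [Finset.card_map, Gadget.card_facet]
    · rw [Finset.card_map, W.card_tri t ht]
  exists_mem_tri := by
    rintro (x | v)
    · obtain ⟨t, ht, hx⟩ := Gadget.exists_facet_inl_self x
      exact ⟨_, W.facet_mem_glueTri ht, Finset.mem_map_of_mem W.emb hx⟩
    · obtain ⟨t, ht, hv⟩ := W.exists_mem_tri v
      exact ⟨_, W.tri_mem_glueTri ht, Finset.mem_map_of_mem _ hv⟩
  pos_nonneg := by
    rintro (x | v) i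
    · exact Gadget.pos_nonneg _ i
    · simp only [gluePos, Sum.elim_inr, Finset.sum_apply, Pi.smul_apply, smul_eq_mul]
      exact Finset.sum_nonneg fun j _ => mul_nonneg (W.pos_nonneg v j) (Gadget.pos_nonneg _ i)
  sum_pos := by
    rintro (x | v)
    · exact Gadget.sum_pos _
    · simp only [gluePos, Sum.elim_inr, Finset.sum_apply, Pi.smul_apply, smul_eq_mul]
      rw [Finset.sum_comm]
      simp only [← Finset.mul_sum, Gadget.sum_pos, mul_one, W.sum_pos]
  pos_out := Gadget.pos_outer
  out_edge i j := by
    obtain ⟨t, ht, hi, hj⟩ := Gadget.exists_facet_outer i j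
    exact ⟨_, W.facet_mem_glueTri ht, Finset.mem_map_of_mem W.emb hi, Finset.mem_map_of_mem W.emb hj⟩
  color_out := Gadget.color_outer
  color_inj := by
    have hc : ∀ x, Sum.elim (fun x => Gadget.color (.inl x)) W.color (W.emb x) =
        Gadget.color x := by
      rintro (x | i)
      · rfl
      · exact W.color_out i
    rintro s (⟨t, -, rfl⟩ | ⟨t, ht, rfl⟩) x hx y hy hxy
    · obtain ⟨x, hx', rfl⟩ := Finset.mem_map.1 hx
      obtain ⟨y, hy', rfl⟩ := Finset.mem_map.1 hy
      rw [hc, hc] at hxy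
      rw [Gadget.color_injOn_facet t x hx' y hy' hxy]
    · obtain ⟨x, hx', rfl⟩ := Finset.mem_map.1 hx
      obtain ⟨y, hy', rfl⟩ := Finset.mem_map.1 hy
      exact congrArg _ (W.color_inj t ht hx' hy' hxy)
  even_degree := W.even_degree_glue
  unique _ ht _ ht' _ _ h0 h0' hw hw' h := W.glue_unique ht ht' h0 h0' hw hw' h
  cover _ hx := W.glue_cover hx

/-- Cyclic shift of the colours together with the corners. -/
def rotate : Triangulation V where
  tri := W.tri
  pos v i := W.pos v (i + 1)
  out i := W.out (i + 1)
  color v := W.color v - 1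
  card_tri := W.card_tri
  exists_mem_tri := W.exists_mem_tri
  pos_nonneg v i := W.pos_nonneg v _
  sum_pos v := (Equiv.sum_comp (Equiv.addRight 1) (W.pos v)).trans (W.sum_pos v)
  pos_out i := by
    funext j
    simp [W.pos_out, Pi.single_apply]
  out_edge i j := W.out_edge _ _
  color_out i := by rw [W.color_out, add_sub_cancel_right]
  color_inj t ht u hu v hv h := W.color_inj t ht hu hv (sub_left_injective h)
  even_degree := W.even_degree
  unique t ht t' ht' w w' h0 h0' hw hw' h := by
    refine W.unique t ht t' ht' w w' h0 h0' hw hw' ?_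
    funext i
    have := congrFun h (i - 1)
    simpa [Finset.sum_apply] using this
  cover x hx := by
    obtain ⟨t, ht, w, h0, hw, h⟩ := W.cover (fun i => x (i - 1)) fun i => hx (i - 1)
    refine ⟨t, ht, w, h0, hw, ?_⟩
    funext i
    have := congrFun h (i + 1)
    simpa [Finset.sum_apply] using this

/-- A single triangle. -/
def triangle : Triangulation (Fin 3) where
  tri := {Finset.univ}
  pos i := Pi.single i 1
  out := id
  color := id
  card_tri := by simp
  exists_mem_tri := by simp
  pos_nonneg v i := by
    rw [Pi.single_apply]
    split_ifs <;> norm_num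
  sum_pos := by simp
  pos_out _ := rfl
  out_edge := by simp
  color_out _ := rfl
  color_inj _ _ := Set.injOn_id _
  even_degree v := by
    have : (facetGraph {Finset.univ}).neighborSet v = (({v}ᶜ : Finset (Fin 3)) : Set (Fin 3)) := by
      ext u
      simp [facetGraph, eq_comm]
    rw [this, Set.ncard_coe_finset, Finset.card_compl]
    simp
  unique _ _ _ _ w w' _ _ _ _ h := by
    funext i
    simpa [Finset.sum_apply, Pi.single_apply] using congrFun h i
  cover x hx := ⟨Finset.univ, rfl, x, hx, by simp, by
    funext i
    simp [Finset.sum_apply, Pi.single_apply]⟩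

end Triangulation

/-! ### Forced vertices in nested gadgets -/

namespace Triangulation

variable {V : Type} [Fintype V] (W : Triangulation V)

/-- `T` induces a tree and hits every bounded face. -/
def IsHittingTree (T : Set V) : Prop :=
  (∀ t ∈ W.tri, ∃ v ∈ T, v ∈ t) ∧ (W.graph.induce T).IsTree

/-- Every tree hitting all bounded faces contains and excludes at least `m c` vertices of each
colour `c`. -/
def IsRich (m : Fin 3 → ℕ) : Prop :=
  ∀ T, W.IsHittingTree T → ∀ c,
    m c ≤ {v | v ∈ T ∧ W.color v = c}.ncard ∧ m c ≤ {v | v ∉ T ∧ W.color v = c}.ncard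

variable {W}

/-- This works because hitting trees need not hit the outer triangle: after gluing, that triangle of
`W` no longer has to bound a face. -/
theorem IsHittingTree.preimage_inr {T : Set (Fin 11 ⊕ V)} (hT : W.glue.IsHittingTree T) :
    W.IsHittingTree (Sum.inr ⁻¹' T) := by
  have hit : ∀ t ∈ W.tri, ∃ v ∈ Sum.inr ⁻¹' T, v ∈ t := by
    intro t ht
    obtain ⟨z, hz, hzt⟩ := hT.1 _ (W.tri_mem_glueTri ht)
    obtain ⟨v, hv, rfl⟩ := Finset.mem_map.1 hzt
    exact ⟨v, hz, hv⟩
  refine ⟨hit, hT.2.induce_preimage W.inrGraph (S := Set.range W.out) ?_ ?_ ?_⟩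
  · rintro _ ⟨i, rfl⟩ _ ⟨j, rfl⟩ hij
    exact W.out_adj fun h => hij (by rw [h])
  · rintro v (x | u) hx hadj
    · obtain ⟨y | i, hy, -⟩ := W.glue_adj_inl.1 hadj.symm
      · exact (Sum.inl_ne_inr hy).elim
      · exact ⟨i, Sum.inr_injective hy⟩
    · exact (hx ⟨u, rfl⟩).elim
  · obtain ⟨t, ht, -⟩ := W.out_edge 0 0
    obtain ⟨v, hv, -⟩ := hit t ht
    exact ⟨v, hv⟩

theorem IsHittingTree.exists_emb {T : Set (Fin 11 ⊕ V)} (hT : W.glue.IsHittingTree T) :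
    (∃ x, W.emb x ∈ T ∧ Gadget.color x = 0) ∧ ∃ x, W.emb x ∉ T ∧ Gadget.color x = 0 := by
  have hit : ∀ t ≠ 22, ∃ x ∈ W.emb ⁻¹' T, x ∈ Gadget.facet t := by
    intro t ht
    obtain ⟨z, hz, hzt⟩ := hT.1 _ (W.facet_mem_glueTri ht)
    obtain ⟨x, hx, rfl⟩ := Finset.mem_map.1 hzt
    exact ⟨x, hz, hx⟩
  have htree : (Gadget.graph.induce (W.emb ⁻¹' T)).IsTree := by
    refine hT.2.induce_preimage W.embGraph (S := Set.range Sum.inr) ?_ ?_ ?_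
    · rintro _ ⟨i, rfl⟩ _ ⟨j, rfl⟩ hij
      exact (Gadget.adj_inr i j).2 fun h => hij (by rw [h])
    · rintro (x | i) z hz hadj
      · obtain ⟨y, rfl, -⟩ := W.glue_adj_inl.1 hadj
        exact (hz ⟨y, rfl⟩).elim
      · exact ⟨i, rfl⟩
    · obtain ⟨x, hx, -⟩ := hit 0 (by decide)
      exact ⟨x, hx⟩
  exact ⟨Gadget.exists_mem_color_zero htree hit, Gadget.exists_notMem_color_zero htree⟩

theorem glue_color_emb (x : Gadget.Vert) : W.glue.color (W.emb x) = Gadget.color x := by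
  cases x with
  | inl x => rfl
  | inr i => exact W.color_out i

/-- Two nested gadgets are needed, since the inner one shares its inner facet with `W`. -/
theorem IsRich.glue_glue {m : Fin 3 → ℕ} (h : W.IsRich m) :
    W.glue.glue.IsRich (m + Pi.single 0 1) := by
  intro T hT c
  have hW := h _ hT.preimage_inr.preimage_inr c
  obtain ⟨⟨x, hx, hxc⟩, y, hy, hyc⟩ := hT.exists_emb
  have key (P : Fin 11 ⊕ (Fin 11 ⊕ V) → Prop)
      (hP : m c ≤ {v : V | P (.inr (.inr v)) ∧ W.color v = c}.ncard) (x : Gadget.Vert)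
      (hx : P (W.glue.emb x)) (hxc : Gadget.color x = 0) :
      (m + Pi.single 0 1 : Fin 3 → ℕ) c ≤ {v | P v ∧ W.glue.glue.color v = c}.ncard := by
    have hinj : Function.Injective fun v : V => (Sum.inr (Sum.inr v) : Fin 11 ⊕ (Fin 11 ⊕ V)) :=
      Sum.inr_injective.comp Sum.inr_injective
    rw [← Set.ncard_image_of_injective _ hinj] at hP
    have hsub : (fun v : V => (Sum.inr (Sum.inr v) : Fin 11 ⊕ (Fin 11 ⊕ V))) ''
        {v : V | P (.inr (.inr v)) ∧ W.color v = c} ⊆ {v | P v ∧ W.glue.glue.color v = c} := by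
      rintro _ ⟨v, hv, rfl⟩
      exact hv
    by_cases hc : c = 0
    · subst hc
      -- Even when `x` is an inner corner of the outer gadget, its image is an outer corner of
      -- `W.glue`, hence not a vertex of `W`; so it is counted in addition.
      have hnot : W.glue.emb x ∉ (fun v : V => (Sum.inr (Sum.inr v) : Fin 11 ⊕ (Fin 11 ⊕ V))) ''
          {v : V | P (.inr (.inr v)) ∧ W.color v = 0} := by
        rintro ⟨v, -, hv⟩
        cases x with
        | inl x => exact Sum.inr_ne_inl hv
        | inr i => exact Sum.inr_ne_inl (Sum.inr_injective hv)
      have hle := Set.ncard_le_ncard (Set.insert_subset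
        (show W.glue.emb x ∈ {v | P v ∧ W.glue.glue.color v = 0} from
          ⟨hx, (glue_color_emb x).trans hxc⟩) hsub)
      rw [Set.ncard_insert_of_notMem hnot] at hle
      simp only [Pi.add_apply, Pi.single_eq_same]
      omega
    · simpa [hc] using hP.trans (Set.ncard_le_ncard hsub)
  exact ⟨key (· ∈ T) hW.1 x hx hxc, key (· ∉ T) hW.2 y hy hyc⟩

theorem IsRich.rotate {m : Fin 3 → ℕ} (h : W.IsRich m) : W.rotate.IsRich fun c => m (c + 1) := by
  intro T hT c
  simpa [Triangulation.rotate, sub_eq_iff_eq_add] using h T hT (c + 1)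

theorem exists_isRich (k : ℕ) :
    ∃ (V : Type) (_ : Fintype V) (W : Triangulation V), W.IsRich fun _ => k := by
  induction k with
  | zero => exact ⟨_, _, triangle, fun _ _ _ => ⟨Nat.zero_le _, Nat.zero_le _⟩⟩
  | succ k ih =>
    obtain ⟨V, _, W, hW⟩ := ih
    refine ⟨_, _, W.glue.glue.rotate.glue.glue.rotate.glue.glue.rotate, ?_⟩
    convert hW.glue_glue.rotate.glue_glue.rotate.glue_glue.rotate using 1
    funext c
    -- Three shifts compose to the identity, and the three added units land on three different
    -- colours.
    fin_cases c <;> simp [Pi.single_apply]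

theorem isHittingTree_of_isPermeatingSubtree {H : W.graph.Subgraph}
    (hH : W.drawing.IsPermeatingSubtree H) : W.IsHittingTree H.verts := by
  obtain ⟨⟨hind, hhit⟩, htree⟩ := hH
  refine ⟨fun t ht => ?_, ?_⟩
  · obtain ⟨v, hv, hinc⟩ := hhit _ (W.isFace_tri ht)
    exact ⟨v, hv, W.mem_of_incident ht hinc⟩
  · have : H.coe = W.graph.induce H.verts := by
      ext u v
      exact ⟨fun h => h.adj_sub, fun h => hind u.2 v.2 h⟩
    rwa [← this]

end Triangulation

theorem mainTheorem4 (k : ℤ) :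
    ∃ (V : Type) (_ : Finite V) (G : SimpleGraph V) (D : PlaneDrawing G) (C : G.Coloring (Fin 3)),
      D.IsTriangulation ∧ IsEulerianGraph G ∧
        ∀ T : G.Subgraph, D.IsPermeatingSubtree T → ∀ c : Fin 3,
          k ≤ ({v : V | v ∈ T.verts ∧ C v = c}.ncard : ℤ) ∧
            k ≤ ({v : V | v ∉ T.verts ∧ C v = c}.ncard : ℤ) := by
  obtain ⟨V, _, W, hW⟩ := Triangulation.exists_isRich k.toNat
  refine ⟨V, inferInstance, W.graph, W.drawing, SimpleGraph.Coloring.mk W.color ?_,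
    W.isTriangulation_drawing, W.even_degree, fun T hT c => ?_⟩
  · rintro u v ⟨hne, t, ht, hu, hv⟩ h
    exact hne (W.color_inj t ht hu hv h)
  · obtain ⟨h1, h2⟩ := hW _ (Triangulation.isHittingTree_of_isPermeatingSubtree hT) c
    exact ⟨(Int.self_le_toNat k).trans (by exact_mod_cast h1),
      (Int.self_le_toNat k).trans (by exact_mod_cast h2)⟩
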